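/- **Polygraphic programs form a Turing-complete model of computation.** *Polygraphic programs.* A polygraphic program is a finite $3$-polygraph with one $0$-cell $\ast$ whose $2$-cells are the structure cells (permutations $\tau_{\xi,\zeta}:\xi\star_0\zeta\Rightarrow\zeta\star_0\xi$, duplications $\delta_\xi:\xi\Rightarrow\xi\star_0\xi$, erasers $\varepsilon_\xi:\xi\Rightarrow\ast$, for all $1$-cells $\xi,\zeta$), constructors $\varphi:x\Rightarrow\xi$ with exactly one output $\xi$, and functions; its $3$-cells are the structure $3$-cells $(\varphi\star_0\zeta)\star_1\tau_{\xi,\zeta}\Rrightarrow\tau_{x,\zeta}\star_1(\zeta\star_0\varphi)$, $(\zeta\star_0\varphi)\star_1\tau_{\zeta,\xi}\Rrightarrow\tau_{\zeta,x}\star_1(\varphi\star_0\zeta)$, $\varphi\star_1\delta_\xi\Rrightarrow\delta_x\star_1(\varphi\star_0\varphi)$, $\varphi\star_1\varepsilon_\xi\Rrightarrow\varepsilon_x$ (for each constructor $\varphi:x\Rightarrow\xi$ and each $1$-cell $\zeta$, with $\tau,\delta,\varepsilon$ extended to $1$-paths in the usual way), and computation $3$-cells, whose $2$-source is of the form $t\star_1\psi$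 with $t$ composed of constructors and $\psi$ a function $2$-cell. A $2$-path $f$ reduces to $g$ when there is a $3$-path $f\Rrightarrow g$ containing exactly one $3$-cell. A value of type $u$ is a $2$-path $\ast\Rightarrow u$ composed of constructors. For a $2$-path $f:u\Rightarrow v$, the partial map $[\![f]\!]$ sends a value $t$ of type $u$ to the value $t'$ of type $v$ if $t\star_1 f$ has a unique normal form and it is $t'$; otherwise it is undefined on $t$. *Turing machines.* A Turing machine $\mathcal M=(\Sigma,Q,q_0,q_f,\delta)$ consists of finite sets $\Sigma$ and $Q$, states $q_0,q_f\in Q$ and a map $\delta:(Q\setminus\{q_f\})\times\overline\Sigma\to Q\times\overline\Sigma\times\{L,R\}$, where $\overline\Sigma=\Sigma\amalg\{\sharp\}$. Its configurations are the $(q,a,w_l,w_r)\in Q\times\overline\Sigma\times\overline\Sigma^*\times\overline\Sigma^*$ ($w_l$ is read from right to left). With $e$ the empty word, its transitions are: * if $\delta(q_1,a)=(q_2,c,L)$: $(q_1,a,e,w_r)\to(q_2,\sharp,e,cw_r)$ and $(q_1,a,bw_l,w_r)\to(q_2,b,w_l,cw_r)$; * if $\delta(q_1,a)=(q_2,c,R)$: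 $(q_1,a,w_l,e)\to(q_2,\sharp,cw_l,e)$ and $(q_1,a,w_l,bw_r)\to(q_2,b,cw_l,w_r)$. $\mathcal M$ computes $f:\Sigma^*\to\Sigma^*$ if for every $w\in\Sigma^*$ there are $a,v$ with $(q_0,\sharp,e,w)\to^*(q_f,a,v,f(w))$. *The program $P(\mathcal M)$.* It has one $1$-cell $\mathtt w$; constructors $\mathrm{nil}:\ast\Rightarrow\mathtt w$ and $\underline a:\mathtt w\Rightarrow\mathtt w$ for $a\in\overline\Sigma$; functions $\mathrm{main}:\mathtt w\Rightarrow\mathtt w$ and $\mathrm{step}_{q,a}:\mathtt w\star_0\mathtt w\Rightarrow\mathtt w$ for $(q,a)\in Q\times\overline\Sigma$. Its computation $3$-cells are * $\mathrm{main}\Rrightarrow(\mathrm{nil}\star_0\mathtt w)\star_1\mathrm{step}_{q_0,\sharp}$; * if $\delta(q_1,a)=(q_2,c,L)$: $(\mathrm{nil}\star_0\mathtt w)\star_1\mathrm{step}_{q_1,a}\Rrightarrow(\mathrm{nil}\star_0\underline c)\star_1\mathrm{step}_{q_2,\sharp}$ and, for each $b\in\overline\Sigma$, $(\underline b\star_0\mathtt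 w)\star_1\mathrm{step}_{q_1,a}\Rrightarrow(\mathtt w\star_0\underline c)\star_1\mathrm{step}_{q_2,b}$; * if $\delta(q_1,a)=(q_2,c,R)$: $(\mathtt w\star_0\mathrm{nil})\star_1\mathrm{step}_{q_1,a}\Rrightarrow(\underline c\star_0\mathrm{nil})\star_1\mathrm{step}_{q_2,\sharp}$ and, for each $b\in\overline\Sigma$, $(\mathtt w\star_0\underline b)\star_1\mathrm{step}_{q_1,a}\Rrightarrow(\underline c\star_0\mathtt w)\star_1\mathrm{step}_{q_2,b}$; * $\mathrm{step}_{q_f,a}\Rrightarrow\varepsilon\star_0\mathtt w$ for each $a\in\overline\Sigma$. Put $\underline e=\mathrm{nil}$, $\underline{aw}=\underline w\star_1\underline a$ and $\underline{(q,a,w_l,w_r)}=(\underline{w_l}\star_0\underline{w_r})\star_1\mathrm{step}_{q,a}$. **Theorem.** For every Turing machine $\mathcal M$, $P(\mathcal M)$ is a polygraphic program and: 1. $w\mapsto\underline w$ is a bijection from $\overline\Sigma^*$ to the values of type $\mathtt w$, and $x\mapsto\underline x$ is injective on configurations. 2. For all configurations $x,y$ and each instance $r$ (that is, a choice of $q_1,a$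 and, where it occurs, $b$) of one of the four cases in the definition of the transitions, $x\to y$ by $r$ if and only if $\underline x$ reduces to $\underline y$ by the $3$-cell of $P(\mathcal M)$ attached to $r$. If $x\to y$, exactly one $3$-cell of $P(\mathcal M)$ reduces $\underline x$ to $\underline y$. Each reduction starting from $\underline x$ is obtained in this way from a transition $x\to y$, unless the state of $x$ is $q_f$ and the $3$-cell used is $\mathrm{step}_{q_f,a}\Rrightarrow\varepsilon\star_0\mathtt w$, where $a$ is the symbol read in $x$. 3. For all configurations $x,y$: $x\to^*y$ if and only if there is a $3$-path $\underline x\Rrightarrow\underline y$. 4. For all $w,v\in\overline\Sigma^*$: $[\![\mathrm{main}]\!](\underline w)$ is defined and equal to $\underline v$ if and only if $(q_0,\sharp,e,w)\to^*(q_f,a,u,v)$ for some $a,u$. 5. If $\mathcal M$ computes $f:\Sigma^*\to\Sigma^*$, then $[\![\mathrm{main}]\!](\underline w)=\underline{f(w)}$ for every $w\in\Sigma^*$. -/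

import Mathlib

universe u

/-! ### Polygraphs of dimension 2 with one 0-cell, and their 2-paths -/

/-- A 2-polygraph with exactly one 0-cell `∗`.  The 1-paths are then the words over the set of
1-cells: `∗` is the empty word and `⋆₀` is concatenation.  A 2-cell goes from a word to a word. -/
structure Polygraph2 where
  OneCell : Type u
  TwoCell : Type u
  source : TwoCell → List OneCell
  target : TwoCell → List OneCell

namespace Polygraph2

variable (P : Polygraph2.{u})

/-- Formal composites of cells; `id u` is the 1-path `u` seen as a (degenerate) 2-path. -/
inductive Term : Type u
  | id (u : List P.OneCell) : Term
  | cell (φ : P.TwoCell) : Term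
  | comp0 (f g : Term) : Term
  | comp1 (f g : Term) : Term

namespace Term

variable {P}

/-- The 1-source `s₁`. -/
def src : P.Term → List P.OneCell
  | id u => u
  | cell φ => P.source φ
  | comp0 f g => f.src ++ g.src
  | comp1 f _ => f.src

/-- The 1-target `t₁`. -/
def tgt : P.Term → List P.OneCell
  | id u => u
  | cell φ => P.target φ
  | comp0 f g => f.tgt ++ g.tgt
  | comp1 _ g => g.tgt

/-- All the 1-compositions in the term are between composable terms. -/
def WF : P.Term → Prop
  | id _ => True
  | cell _ => True
  | comp0 f g => f.WF ∧ g.WF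
  | comp1 f g => f.WF ∧ g.WF ∧ f.tgt = g.src

open Classical in
/-- The size of a term with respect to a set `X` of 2-cells: the number of occurrences in it of
elements of `X`. -/
noncomputable def size (X : Set P.TwoCell) : P.Term → ℕ
  | id _ => 0
  | cell φ => if φ ∈ X then 1 else 0
  | comp0 f g => f.size X + g.size X
  | comp1 f g => f.size X + g.size X

/-- The relations under which 2-paths are identified: associativity, local units and exchange,
applied anywhere inside a term.  The relation `id_comp0` says that the 0-composition of 2-paths
extends the one of 1-paths. -/
inductive Rel : P.Term → P.Term → Prop
  | assoc0 (f g h : P.Term) : Rel ((f.comp0 g).comp0 h) (f.comp0 (g.comp0 h))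
  | assoc1 (f g h : P.Term) : Rel ((f.comp1 g).comp1 h) (f.comp1 (g.comp1 h))
  | unit0_left (f : P.Term) : Rel ((id []).comp0 f) f
  | unit0_right (f : P.Term) : Rel (f.comp0 (id [])) f
  | unit1_left (f : P.Term) : Rel ((id f.src).comp1 f) f
  | unit1_right (f : P.Term) : Rel (f.comp1 (id f.tgt)) f
  | id_comp0 (u v : List P.OneCell) : Rel ((id u).comp0 (id v)) (id (u ++ v))
  | exchange (f₁ f₂ g₁ g₂ : P.Term) (h₁ : f₁.tgt = g₁.src) (h₂ : f₂.tgt = g₂.src) :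
      Rel ((f₁.comp0 f₂).comp1 (g₁.comp0 g₂)) ((f₁.comp1 g₁).comp0 (f₂.comp1 g₂))
  | comp0_left {f f' : P.Term} (g : P.Term) : Rel f f' → Rel (f.comp0 g) (f'.comp0 g)
  | comp0_right (f : P.Term) {g g' : P.Term} : Rel g g' → Rel (f.comp0 g) (f.comp0 g')
  | comp1_left {f f' : P.Term} (g : P.Term) : Rel f f' → Rel (f.comp1 g) (f'.comp1 g)
  | comp1_right (f : P.Term) {g g' : P.Term} : Rel g g' → Rel (f.comp1 g) (f.comp1 g')

theorem Rel.src_eq {f g : P.Term} (h : Rel f g) : f.src = g.src := by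
  induction h <;> simp_all [src]

theorem Rel.tgt_eq {f g : P.Term} (h : Rel f g) : f.tgt = g.tgt := by
  induction h <;> simp_all [tgt]

theorem Rel.wf_eq {f g : P.Term} (h : Rel f g) : f.WF = g.WF := by
  induction h with
  | comp1_left g hr ih => simp only [WF, ih, hr.tgt_eq]
  | comp1_right f hr ih => simp only [WF, ih, hr.src_eq]
  | _ => simp_all [WF, src, tgt] <;> tauto

theorem Rel.size_eq (X : Set P.TwoCell) {f g : P.Term} (h : Rel f g) : f.size X = g.size X := by
  induction h <;> simp_all [size] <;> omega

end Term

/-- The 2-paths: well-formed terms modulo associativity, local units and exchange.  (All the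
relations preserve well-formedness, so that only well-formed terms are identified with a
well-formed term.) -/
def Path2 : Type u :=
  {x : Quot (Term.Rel (P := P)) // Quot.lift Term.WF (fun _ _ h => h.wf_eq) x}

namespace Path2

variable {P}

/-- The 1-source of a 2-path. -/
def src (f : P.Path2) : List P.OneCell := Quot.lift Term.src (fun _ _ h => h.src_eq) f.1

/-- The 1-target of a 2-path. -/
def tgt (f : P.Path2) : List P.OneCell := Quot.lift Term.tgt (fun _ _ h => h.tgt_eq) f.1

/-- The size of a 2-path with respect to a set of 2-cells. -/
noncomputable def size (X : Set P.TwoCell) (f : P.Path2) : ℕ :=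
  Quot.lift (Term.size X) (fun _ _ h => h.size_eq X) f.1

/-- A 1-path, seen as a degenerate 2-path. -/
def id (u : List P.OneCell) : P.Path2 := ⟨Quot.mk _ (Term.id u), trivial⟩

/-- A 2-cell, seen as a 2-path. -/
def cell (φ : P.TwoCell) : P.Path2 := ⟨Quot.mk _ (Term.cell φ), trivial⟩

/-- The 0-composition `f ⋆₀ g`. -/
def comp0 (f g : P.Path2) : P.Path2 :=
  ⟨Quot.map₂ Term.comp0 (fun f _ _ h => Term.Rel.comp0_right f h)
      (fun _ _ g h => Term.Rel.comp0_left g h) f.1 g.1, by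
    obtain ⟨⟨f⟩, hf⟩ := f
    obtain ⟨⟨g⟩, hg⟩ := g
    exact ⟨hf, hg⟩⟩

/-- The 1-composition `f ⋆₁ g` of composable 2-paths. -/
def comp1 (f g : P.Path2) (h : f.tgt = g.src) : P.Path2 :=
  ⟨Quot.map₂ Term.comp1 (fun f _ _ h => Term.Rel.comp1_right f h)
      (fun _ _ g h => Term.Rel.comp1_left g h) f.1 g.1, by
    obtain ⟨⟨f⟩, hf⟩ := f
    obtain ⟨⟨g⟩, hg⟩ := g
    exact ⟨hf, hg, h⟩⟩

theorem src_comp0 (f g : P.Path2) : (f.comp0 g).src = f.src ++ g.src := by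
  obtain ⟨⟨f⟩, hf⟩ := f
  obtain ⟨⟨g⟩, hg⟩ := g
  rfl

theorem tgt_comp0 (f g : P.Path2) : (f.comp0 g).tgt = f.tgt ++ g.tgt := by
  obtain ⟨⟨f⟩, hf⟩ := f
  obtain ⟨⟨g⟩, hg⟩ := g
  rfl

theorem src_comp1 (f g : P.Path2) (h : f.tgt = g.src) : (f.comp1 g h).src = f.src := by
  obtain ⟨⟨f⟩, hf⟩ := f
  obtain ⟨⟨g⟩, hg⟩ := g
  rfl

theorem tgt_comp1 (f g : P.Path2) (h : f.tgt = g.src) : (f.comp1 g h).tgt = g.tgt := by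
  obtain ⟨⟨f⟩, hf⟩ := f
  obtain ⟨⟨g⟩, hg⟩ := g
  rfl

theorem size_comp0 (X : Set P.TwoCell) (f g : P.Path2) :
    (f.comp0 g).size X = f.size X + g.size X := by
  obtain ⟨⟨f⟩, hf⟩ := f
  obtain ⟨⟨g⟩, hg⟩ := g
  rfl

theorem size_comp1 (X : Set P.TwoCell) (f g : P.Path2) (h : f.tgt = g.src) :
    (f.comp1 g h).size X = f.size X + g.size X := by
  obtain ⟨⟨f⟩, hf⟩ := f
  obtain ⟨⟨g⟩, hg⟩ := g
  rfl

/-- `f` belongs to `X*`, i.e. it is a composite of 2-cells in `X` (and of 1-cells). -/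
def GeneratedBy (X : Set P.TwoCell) (f : P.Path2) : Prop := f.size Xᶜ = 0

end Path2

/-- The 2-paths `u ⇒ v`. -/
def Hom (u v : List P.OneCell) : Type u := {f : P.Path2 // f.src = u ∧ f.tgt = v}

namespace Hom

variable {P}
variable {u v w u' v' : List P.OneCell}

/-- Rewriting the 1-source and the 1-target along equalities. -/
def cast (f : P.Hom u v) (hu : u = u') (hv : v = v') : P.Hom u' v' :=
  ⟨f.1, f.2.1.trans hu, f.2.2.trans hv⟩

/-- A 1-path as a degenerate 2-path. -/
def id (u : List P.OneCell) : P.Hom u u := ⟨Path2.id u, rfl, rfl⟩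

/-- A 2-cell as a 2-path. -/
def cell (φ : P.TwoCell) : P.Hom (P.source φ) (P.target φ) := ⟨Path2.cell φ, rfl, rfl⟩

/-- The 0-composition. -/
def comp0 (f : P.Hom u v) (g : P.Hom u' v') : P.Hom (u ++ u') (v ++ v') :=
  ⟨f.1.comp0 g.1, by rw [Path2.src_comp0, f.2.1, g.2.1], by rw [Path2.tgt_comp0, f.2.2, g.2.2]⟩

/-- The 1-composition. -/
def comp1 (f : P.Hom u v) (g : P.Hom v w) : P.Hom u w :=
  ⟨f.1.comp1 g.1 (f.2.2.trans g.2.1.symm), by rw [Path2.src_comp1, f.2.1],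
    by rw [Path2.tgt_comp1, g.2.2]⟩

end Hom

end Polygraph2

/-! ### Polygraphs of dimension 3 with one 0-cell, and their 3-paths -/

/-- A 3-polygraph with one 0-cell: the 2-source and the 2-target of each 3-cell are parallel
2-paths. -/
structure Polygraph3 extends Polygraph2.{u} where
  ThreeCell : Type u
  dom : ThreeCell → List OneCell
  cod : ThreeCell → List OneCell
  source3 : (α : ThreeCell) → toPolygraph2.Hom (dom α) (cod α)
  target3 : (α : ThreeCell) → toPolygraph2.Hom (dom α) (cod α)

namespace Polygraph3

variable (P : Polygraph3.{u})

/-- (Representatives of) the 3-paths `f ⇛ g`: the formal composites of 3-cells and 2-paths under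
the three compositions.  Two of them are the same 3-path when they differ by associativity, local
units and exchange; these relations change neither the 2-source and 2-target nor the sizes below,
and only the existence of 3-paths of given sizes is used, so the quotient is not formed.  In
`comp1`, each of the two composability conditions follows from the other one. -/
inductive Path3 : P.Path2 → P.Path2 → Type u
  | id (f : P.Path2) : Path3 f f
  | cell (α : P.ThreeCell) : Path3 (P.source3 α).1 (P.target3 α).1
  | comp0 {f f' g g' : P.Path2} (F : Path3 f f') (G : Path3 g g') :
      Path3 (f.comp0 g) (f'.comp0 g')
  | comp1 {f f' g g' : P.Path2} (h : f.tgt = g.src) (h' : f'.tgt = g'.src)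
      (F : Path3 f f') (G : Path3 g g') : Path3 (f.comp1 g h) (f'.comp1 g' h')
  | comp2 {f g h : P.Path2} (F : Path3 f g) (G : Path3 g h) : Path3 f h

variable {P}

open Classical in
/-- The size of a 3-path with respect to a set `X` of 3-cells. -/
noncomputable def Path3.size (X : Set P.ThreeCell) : {f g : P.Path2} → P.Path3 f g → ℕ
  | _, _, .id _ => 0
  | _, _, .cell α => if α ∈ X then 1 else 0
  | _, _, .comp0 F G => F.size X + G.size X
  | _, _, .comp1 _ _ F G => F.size X + G.size X
  | _, _, .comp2 F G => F.size X + G.size X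

/-- `f ⇛ g`: there is a 3-path (possibly degenerate) from `f` to `g`. -/
def HasPath (f g : P.Path2) : Prop := Nonempty (P.Path3 f g)

/-- There is an arrow `f → g` in the reduction graph: an elementary 3-path, i.e. a 3-path of
size 1. -/
def Reduces (f g : P.Path2) : Prop := ∃ F : P.Path3 f g, F.size Set.univ = 1

/-- There is an elementary 3-path from `f` to `g` whose only 3-cell is `α`. -/
def ReducesBy (α : P.ThreeCell) (f g : P.Path2) : Prop :=
  ∃ F : P.Path3 f g, F.size Set.univ = 1 ∧ F.size {α} = 1

/-- No reduction starts from `f`. -/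
def IsNormal (f : P.Path2) : Prop := ∀ g, ¬ Reduces f g

/-- `g` is a normal form of `f`. -/
def IsNormalFormOf (g f : P.Path2) : Prop := Relation.ReflTransGen Reduces f g ∧ IsNormal g

end Polygraph3

/-! ### Polygraphic programs -/

/-- The 1-cells, constructor 2-cells and function 2-cells of a polygraphic program. -/
structure Signature where
  OneCell : Type u
  Con : Type u
  Fun : Type u
  conSource : Con → List OneCell
  conTarget : Con → OneCell
  funSource : Fun → List OneCell
  funTarget : Fun → List OneCell

namespace Signature

variable (S : Signature.{u})

/-- The 2-cells of a polygraphic program: the structure 2-cells (permutations `τ`, duplications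
`δ` and erasers `ε`), the constructors and the functions. -/
inductive Cell : Type u
  | swap (ξ ζ : S.OneCell) : Cell
  | dup (ξ : S.OneCell) : Cell
  | erase (ξ : S.OneCell) : Cell
  | con (φ : S.Con) : Cell
  | func (φ : S.Fun) : Cell

/-- The underlying 2-polygraph: `τ : ξ ⋆₀ ζ ⇒ ζ ⋆₀ ξ`, `δ : ξ ⇒ ξ ⋆₀ ξ`, `ε : ξ ⇒ ∗`. -/
def poly2 : Polygraph2.{u} where
  OneCell := S.OneCell
  TwoCell := S.Cell
  source
    | .swap ξ ζ => [ξ, ζ]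
    | .dup ξ => [ξ]
    | .erase ξ => [ξ]
    | .con φ => S.conSource φ
    | .func φ => S.funSource φ
  target
    | .swap ξ ζ => [ζ, ξ]
    | .dup ξ => [ξ, ξ]
    | .erase _ => []
    | .con φ => [S.conTarget φ]
    | .func φ => S.funTarget φ

/-- The set of constructor 2-cells. -/
def conCells : Set S.poly2.TwoCell := Set.range Cell.con

variable {S}

/-- The 2-cell `τ`, as a 2-path. -/
def swapCell (ξ ζ : S.OneCell) : S.poly2.Hom [ξ, ζ] [ζ, ξ] :=
  Polygraph2.Hom.cell (P := S.poly2) (Cell.swap ξ ζ)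

/-- The 2-cell `δ`, as a 2-path. -/
def dupCell (ξ : S.OneCell) : S.poly2.Hom [ξ] [ξ, ξ] :=
  Polygraph2.Hom.cell (P := S.poly2) (Cell.dup ξ)

/-- The 2-cell `ε`, as a 2-path. -/
def eraseCell (ξ : S.OneCell) : S.poly2.Hom [ξ] [] :=
  Polygraph2.Hom.cell (P := S.poly2) (Cell.erase ξ)

/-- A constructor 2-cell, as a 2-path. -/
def conCell (φ : S.Con) : S.poly2.Hom (S.conSource φ) [S.conTarget φ] :=
  Polygraph2.Hom.cell (P := S.poly2) (Cell.con φ)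

/-- A function 2-cell, as a 2-path. -/
def funCell (φ : S.Fun) : S.poly2.Hom (S.funSource φ) (S.funTarget φ) :=
  Polygraph2.Hom.cell (P := S.poly2) (Cell.func φ)

/-- The identity 2-path of a 1-path. -/
def wires (x : List S.OneCell) : S.poly2.Hom x x := Polygraph2.Hom.id (P := S.poly2) x

/-- The structure 2-path `τ_{x,ζ} : x ⋆₀ ζ ⇒ ζ ⋆₀ x`. -/
def swapLeft : (x : List S.OneCell) → (ζ : S.OneCell) → S.poly2.Hom (x ++ [ζ]) (ζ :: x)
  | [], ζ => wires [ζ]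
  | ξ :: x, ζ => Polygraph2.Hom.comp1 (P := S.poly2) (v := ξ :: ζ :: x)
      ((wires [ξ]).comp0 (swapLeft x ζ)) ((swapCell ξ ζ).comp0 (wires x))

/-- The structure 2-path `τ_{ζ,x} : ζ ⋆₀ x ⇒ x ⋆₀ ζ`. -/
def swapRight (ζ : S.OneCell) : (x : List S.OneCell) → S.poly2.Hom (ζ :: x) (x ++ [ζ])
  | [] => wires [ζ]
  | ξ :: x => Polygraph2.Hom.comp1 (P := S.poly2) (v := ξ :: ζ :: x)
      ((swapCell ζ ξ).comp0 (wires x)) ((wires [ξ]).comp0 (swapRight ζ x))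

/-- The structure 2-path `δ_x : x ⇒ x ⋆₀ x`. -/
def dupPath : (x : List S.OneCell) → S.poly2.Hom x (x ++ x)
  | [] => wires []
  | ξ :: x => Polygraph2.Hom.comp1 (P := S.poly2) (v := [ξ, ξ] ++ (x ++ x))
      ((dupCell ξ).comp0 (dupPath x))
      (Polygraph2.Hom.cast (P := S.poly2) (u := [ξ] ++ (ξ :: x) ++ x) (((wires [ξ]).comp0 (swapRight ξ x)).comp0 (wires x))
        (List.append_assoc [ξ, ξ] x x) (by
          change ([ξ] ++ (x ++ [ξ])) ++ x = (ξ :: x) ++ (ξ :: x)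
          simp))

/-- The structure 2-path `ε_x : x ⇒ ∗`. -/
def erasePath : (x : List S.OneCell) → S.poly2.Hom x []
  | [] => wires []
  | ξ :: x => (eraseCell ξ).comp0 (erasePath x)

variable (S)

/-- The structure 3-cells, for every constructor `φ : x ⇒ ξ` and every 1-cell `ζ`. -/
inductive StructCell : Type u
  | swapLeft (φ : S.Con) (ζ : S.OneCell) : StructCell
  | swapRight (ζ : S.OneCell) (φ : S.Con) : StructCell
  | dup (φ : S.Con) : StructCell
  | erase (φ : S.Con) : StructCell

namespace StructCell

variable {S}

/-- The 1-source of a structure 3-cell. -/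
def dom : S.StructCell → List S.OneCell
  | swapLeft φ ζ => S.conSource φ ++ [ζ]
  | swapRight ζ φ => ζ :: S.conSource φ
  | dup φ => S.conSource φ
  | erase φ => S.conSource φ

/-- The 1-target of a structure 3-cell. -/
def cod : S.StructCell → List S.OneCell
  | swapLeft φ ζ => [ζ, S.conTarget φ]
  | swapRight ζ φ => [S.conTarget φ, ζ]
  | dup φ => [S.conTarget φ, S.conTarget φ]
  | erase _ => []

/-- The 2-sources `(φ ⋆₀ ζ) ⋆₁ τ_{ξ,ζ}`, `(ζ ⋆₀ φ) ⋆₁ τ_{ζ,ξ}`, `φ ⋆₁ δ_ξ`, `φ ⋆₁ ε_ξ`. -/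
def source : (α : S.StructCell) → S.poly2.Hom α.dom α.cod
  | swapLeft φ ζ => ((conCell φ).comp0 (wires [ζ])).comp1 (swapCell (S.conTarget φ) ζ)
  | swapRight ζ φ => ((wires [ζ]).comp0 (conCell φ)).comp1 (swapCell ζ (S.conTarget φ))
  | dup φ => (conCell φ).comp1 (dupCell (S.conTarget φ))
  | erase φ => (conCell φ).comp1 (eraseCell (S.conTarget φ))

/-- The 2-targets `τ_{x,ζ} ⋆₁ (ζ ⋆₀ φ)`, `τ_{ζ,x} ⋆₁ (φ ⋆₀ ζ)`, `δ_x ⋆₁ (φ ⋆₀ φ)`, `ε_x`. -/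
def target : (α : S.StructCell) → S.poly2.Hom α.dom α.cod
  | swapLeft φ ζ => Polygraph2.Hom.comp1 (P := S.poly2) (v := ζ :: S.conSource φ)
      (Signature.swapLeft (S.conSource φ) ζ) ((wires [ζ]).comp0 (conCell φ))
  | swapRight ζ φ => (Signature.swapRight ζ (S.conSource φ)).comp1
      ((conCell φ).comp0 (wires [ζ]))
  | dup φ => (dupPath (S.conSource φ)).comp1 ((conCell φ).comp0 (conCell φ))
  | erase φ => erasePath (S.conSource φ)

end StructCell

end Signature

/-- A polygraphic program: it has finitely many cells, and the 2-source of each computation 3-cell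
has the shape `t ⋆₁ φ`, where `t` is a composite of constructors and `φ` is a function 2-cell. -/
structure PolygraphicProgram extends Signature.{u} where
  Comp : Type u
  compDom : Comp → List OneCell
  compCod : Comp → List OneCell
  compSource : (α : Comp) → toSignature.poly2.Hom (compDom α) (compCod α)
  compTarget : (α : Comp) → toSignature.poly2.Hom (compDom α) (compCod α)
  compSource_shape : ∀ α : Comp, ∃ (t : toSignature.poly2.Path2) (φ : Fun)
    (h : t.tgt = (Signature.funCell φ).1.src), t.GeneratedBy toSignature.conCells ∧
      (compSource α).1 = t.comp1 (Signature.funCell φ).1 h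
  finite_oneCell : Finite OneCell
  finite_con : Finite Con
  finite_fun : Finite Fun
  finite_comp : Finite Comp

namespace PolygraphicProgram

variable (P : PolygraphicProgram.{u})

/-- The 3-polygraph of a program; its 3-cells are the structure ones and the computation ones. -/
def poly3 : Polygraph3.{u} where
  toPolygraph2 := P.poly2
  ThreeCell := P.StructCell ⊕ P.Comp
  dom
    | .inl α => α.dom
    | .inr α => P.compDom α
  cod
    | .inl α => α.cod
    | .inr α => P.compCod α
  source3
    | .inl α => α.source
    | .inr α => P.compSource α
  target3
    | .inl α => α.target
    | .inr α => P.compTarget α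

/-- The values of type `u`: the composites of constructors with source `∗` and target `u`. -/
def Value (u : List P.OneCell) : Type u :=
  {t : P.poly2.Hom [] u // t.1.GeneratedBy P.conCells}

variable {P}

/-- The 2-path `t ⋆₁ f`, where `t` is a value. -/
def applyTo {u v : List P.OneCell} (f : P.poly2.Hom u v) (t : P.Value u) : P.poly3.Path2 :=
  (t.1.comp1 f).1

/-- The semantics of a 2-path `f : u ⇒ v`, a partial map from the values of type `u` to the ones of
type `v`: it sends `t` to `t'` when `t ⋆₁ f` has a unique normal form, which is the value `t'`, and
it is undefined on `t` otherwise. -/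
noncomputable def sem {u v : List P.OneCell} (f : P.poly2.Hom u v) : P.Value u →. P.Value v :=
  fun t => ⟨∃ t' : P.Value v, ∀ y : P.poly3.Path2,
    Polygraph3.IsNormalFormOf y (applyTo f t) ↔ y = t'.1.1, fun h => h.choose⟩

end PolygraphicProgram

/-! ### Turing machines -/

/-- The two directions. -/
inductive Dir : Type
  | L
  | R

/-- A Turing machine with alphabet `A` and set of states `Q`.  The extended alphabet is `Option A`,
with blank character `none`. -/
structure TuringMachine (A Q : Type u) where
  q0 : Q
  qf : Q
  δ : {q : Q // q ≠ qf} × Option A → Q × Option A × Dir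

namespace TuringMachine

variable {A Q : Type u} (M : TuringMachine A Q)

/-- The configurations `(q, a, w_l, w_r)`; the word `w_l` is written in reverse order. -/
structure Config (M : TuringMachine A Q) : Type u where
  state : Q
  read : Option A
  left : List (Option A)
  right : List (Option A)

/-- The instances of the four cases in the definition of the transition relation: left or right
move, with an empty or a non-empty word on the side of the move. -/
inductive Rule : Type u
  | leftNil (q₁ : {q : Q // q ≠ M.qf}) (a : Option A) (q₂ : Q) (c : Option A)
      (h : M.δ (q₁, a) = (q₂, c, Dir.L)) : Rule
  | leftCons (q₁ : {q : Q // q ≠ M.qf}) (a : Option A) (q₂ : Q) (c : Option A)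
      (h : M.δ (q₁, a) = (q₂, c, Dir.L)) (b : Option A) : Rule
  | rightNil (q₁ : {q : Q // q ≠ M.qf}) (a : Option A) (q₂ : Q) (c : Option A)
      (h : M.δ (q₁, a) = (q₂, c, Dir.R)) : Rule
  | rightCons (q₁ : {q : Q // q ≠ M.qf}) (a : Option A) (q₂ : Q) (c : Option A)
      (h : M.δ (q₁, a) = (q₂, c, Dir.R)) (b : Option A) : Rule

/-- The transitions, each one with the case of the definition it is obtained from. -/
inductive StepBy : M.Rule → M.Config → M.Config → Prop
  | leftNil (q₁ a q₂ c h) (wr : List (Option A)) :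
      StepBy (.leftNil q₁ a q₂ c h) ⟨q₁, a, [], wr⟩ ⟨q₂, none, [], c :: wr⟩
  | leftCons (q₁ a q₂ c h b) (wl wr : List (Option A)) :
      StepBy (.leftCons q₁ a q₂ c h b) ⟨q₁, a, b :: wl, wr⟩ ⟨q₂, b, wl, c :: wr⟩
  | rightNil (q₁ a q₂ c h) (wl : List (Option A)) :
      StepBy (.rightNil q₁ a q₂ c h) ⟨q₁, a, wl, []⟩ ⟨q₂, none, c :: wl, []⟩
  | rightCons (q₁ a q₂ c h b) (wl wr : List (Option A)) :
      StepBy (.rightCons q₁ a q₂ c h b) ⟨q₁, a, wl, b :: wr⟩ ⟨q₂, b, c :: wl, wr⟩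

/-- The transition relation. -/
def Step (x y : M.Config) : Prop := ∃ r, M.StepBy r x y

/-- The reflexive and transitive closure of the transition relation. -/
def Steps : M.Config → M.Config → Prop := Relation.ReflTransGen M.Step

/-- The initial configuration on the word `w`. -/
def start (w : List (Option A)) : M.Config := ⟨M.q0, none, [], w⟩

/-- `M` computes the map `f : A* → A*`. -/
def Computes (f : List A → List A) : Prop :=
  ∀ w : List A, ∃ (a : Option A) (v : List (Option A)),
    M.Steps (M.start (w.map some)) ⟨M.qf, a, v, (f w).map some⟩

/-! ### The polygraphic program of a Turing machine -/

/-- Constructors: the empty word, and one for each element of the extended alphabet. -/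
inductive Letter (A : Type u) : Type u
  | nil : Letter A
  | letter (a : Option A) : Letter A

/-- Functions: the main one, and one for each pair of a state and a character. -/
inductive Op (A Q : Type u) : Type u
  | main : Op A Q
  | step (q : Q) (a : Option A) : Op A Q

/-- The signature of the program; its only 1-cell is `w`. -/
def sig (A Q : Type u) : Signature.{u} where
  OneCell := PUnit
  Con := Letter A
  Fun := Op A Q
  conSource
    | .nil => []
    | .letter _ => [PUnit.unit]
  conTarget _ := PUnit.unit
  funSource
    | .main => [PUnit.unit]
    | .step _ _ => [PUnit.unit, PUnit.unit]
  funTarget _ := [PUnit.unit]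

/-- The 1-cell `w`, as a 1-path. -/
abbrev W (A Q : Type u) : List (sig A Q).OneCell := [PUnit.unit]

/-- The 1-path `w ⋆₀ w`. -/
abbrev WW (A Q : Type u) : List (sig A Q).OneCell := [PUnit.unit, PUnit.unit]

/-- The 2-path `w ⇒ w` consisting of one wire. -/
def wire : (sig A Q).poly2.Hom (W A Q) (W A Q) := Signature.wires (W A Q)

/-- The constructor of the empty word. -/
def nil : (sig A Q).poly2.Hom [] (W A Q) := Signature.conCell (S := sig A Q) Letter.nil

/-- The constructor of a letter. -/
def letter (a : Option A) : (sig A Q).poly2.Hom (W A Q) (W A Q) :=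
  Signature.conCell (S := sig A Q) (Letter.letter a)

/-- The eraser. -/
def eraser : (sig A Q).poly2.Hom (W A Q) [] := Signature.eraseCell (S := sig A Q) PUnit.unit

/-- The main function. -/
def main : (sig A Q).poly2.Hom (W A Q) (W A Q) := Signature.funCell (S := sig A Q) Op.main

/-- The function 2-cell of a state and a character. -/
def step (q : Q) (a : Option A) : (sig A Q).poly2.Hom (WW A Q) (W A Q) :=
  Signature.funCell (S := sig A Q) (Op.step q a)

/-- `(f ⋆₀ g) ⋆₁ step q a`. -/
def feed {u v : List (sig A Q).OneCell} (f : (sig A Q).poly2.Hom u (W A Q))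
    (g : (sig A Q).poly2.Hom v (W A Q)) (q : Q) (a : Option A) :
    (sig A Q).poly2.Hom (u ++ v) (W A Q) :=
  Polygraph2.Hom.comp1 (P := (sig A Q).poly2) (v := WW A Q) (f.comp0 g) (step q a)

/-- The computation 3-cells: the initialization, the simulation of the transitions and the
computation of the result. -/
inductive Comp : Type u
  | init : Comp
  | trans (r : M.Rule) : Comp
  | finish (a : Option A) : Comp

variable {M}

/-- The 1-source of a computation 3-cell. -/
def compDom : M.Comp → List (sig A Q).OneCell
  | .init => W A Q
  | .trans (.leftNil ..) => W A Q
  | .trans (.leftCons ..) => WW A Q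
  | .trans (.rightNil ..) => W A Q
  | .trans (.rightCons ..) => WW A Q
  | .finish _ => WW A Q

/-- The 2-source of a computation 3-cell. -/
def compSource : (α : M.Comp) → (sig A Q).poly2.Hom (compDom α) (W A Q)
  | .init => main
  | .trans (.leftNil q₁ a _ _ _) => feed nil wire q₁ a
  | .trans (.leftCons q₁ a _ _ _ b) => feed (letter b) wire q₁ a
  | .trans (.rightNil q₁ a _ _ _) => feed wire nil q₁ a
  | .trans (.rightCons q₁ a _ _ _ b) => feed wire (letter b) q₁ a
  | .finish a => step M.qf a

/-- The 2-target of a computation 3-cell. -/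
def compTarget : (α : M.Comp) → (sig A Q).poly2.Hom (compDom α) (W A Q)
  | .init => feed nil wire M.q0 none
  | .trans (.leftNil _ _ q₂ c _) => feed nil (letter c) q₂ none
  | .trans (.leftCons _ _ q₂ c _ b) => feed wire (letter c) q₂ b
  | .trans (.rightNil _ _ q₂ c _) => feed (letter c) nil q₂ none
  | .trans (.rightCons _ _ q₂ c _ b) => feed (letter c) wire q₂ b
  | .finish _ => eraser.comp0 wire

theorem nil_generated : (nil (A := A) (Q := Q)).1.GeneratedBy (sig A Q).conCells :=
  if_neg (not_not.mpr ⟨Letter.nil, rfl⟩)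

theorem letter_generated (a : Option A) :
    (letter (Q := Q) a).1.GeneratedBy (sig A Q).conCells :=
  if_neg (not_not.mpr ⟨Letter.letter a, rfl⟩)

theorem wire_generated : (wire (A := A) (Q := Q)).1.GeneratedBy (sig A Q).conCells := rfl

theorem shape_feed {u v : List (sig A Q).OneCell} (f : (sig A Q).poly2.Hom u (W A Q))
    (g : (sig A Q).poly2.Hom v (W A Q)) (q : Q) (a : Option A)
    (hf : f.1.GeneratedBy (sig A Q).conCells) (hg : g.1.GeneratedBy (sig A Q).conCells) :
    ∃ (t : (sig A Q).poly2.Path2) (φ : (sig A Q).Fun)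
      (h : t.tgt = (Signature.funCell φ).1.src), t.GeneratedBy (sig A Q).conCells ∧
        (feed f g q a).1 = t.comp1 (Signature.funCell φ).1 h := by
  refine ⟨(f.comp0 g).1, Op.step q a, (f.comp0 g).2.2, ?_, rfl⟩
  change (Polygraph2.Path2.comp0 f.1 g.1).size _ = 0
  rw [Polygraph2.Path2.size_comp0]
  exact Nat.add_eq_zero_iff.mpr ⟨hf, hg⟩

theorem shape_cell (φ : (sig A Q).Fun) :
    ∃ (t : (sig A Q).poly2.Path2) (ψ : (sig A Q).Fun)
      (h : t.tgt = (Signature.funCell ψ).1.src), t.GeneratedBy (sig A Q).conCells ∧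
        (Signature.funCell φ).1 = t.comp1 (Signature.funCell ψ).1 h :=
  ⟨(Signature.wires ((sig A Q).funSource φ)).1, φ, rfl, rfl, Subtype.ext
    (Quot.sound (Polygraph2.Term.Rel.unit1_left
      (Polygraph2.Term.cell (P := (sig A Q).poly2) (Signature.Cell.func φ)))).symm⟩

theorem finite_letter [Finite A] : Finite (Letter A) :=
  Finite.of_injective (fun x : Letter A => match x with
    | .nil => none
    | .letter a => some a) (by rintro (_ | _) (_ | _) h <;> simp_all)

theorem finite_op [Finite A] [Finite Q] : Finite (Op A Q) :=
  Finite.of_injective (fun x : Op A Q => match x with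
    | .main => none
    | .step q a => some (q, a)) (by rintro (_ | _) (_ | _) h <;> simp_all)

theorem finite_rule [Finite A] [Finite Q] : Finite M.Rule :=
  Finite.of_injective (fun x : M.Rule => match x with
    | .leftNil q₁ a _ _ _ => (q₁, a, true, none)
    | .leftCons q₁ a _ _ _ b => (q₁, a, true, some b)
    | .rightNil q₁ a _ _ _ => (q₁, a, false, none)
    | .rightCons q₁ a _ _ _ b => (q₁, a, false, some b)) (by
      rintro (⟨q, a, q₂, c, h⟩ | ⟨q, a, q₂, c, h, b⟩ | ⟨q, a, q₂, c, h⟩ | ⟨q, a, q₂, c, h, b⟩)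
        (⟨q', a', q₂', c', h'⟩ | ⟨q', a', q₂', c', h', b'⟩ | ⟨q', a', q₂', c', h'⟩ |
          ⟨q', a', q₂', c', h', b'⟩) e <;>
      simp only [Prod.mk.injEq, reduceCtorEq, and_false, Bool.true_eq_false, Bool.false_eq_true,
        false_and, Option.some.injEq, and_true] at e <;>
      (obtain ⟨rfl, rfl, -, rfl⟩ := e
       rw [h] at h'
       simp only [Prod.mk.injEq] at h'
       obtain ⟨rfl, rfl, -⟩ := h'
       rfl))

theorem finite_comp [Finite A] [Finite Q] : Finite M.Comp :=
  have : Finite M.Rule := finite_rule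
  Finite.of_injective (fun x : M.Comp => match x with
    | .init => (Sum.inl PUnit.unit : PUnit.{1} ⊕ M.Rule ⊕ Option A)
    | .trans r => .inr (.inl r)
    | .finish a => .inr (.inr a)) (by rintro (_ | _ | _) (_ | _ | _) h <;> simp_all)

variable (M)

/-- The polygraphic program of the Turing machine `M`. -/
def program [Finite A] [Finite Q] : PolygraphicProgram.{u} where
  toSignature := sig A Q
  Comp := M.Comp
  compDom := compDom
  compCod _ := W A Q
  compSource := compSource
  compTarget := compTarget
  compSource_shape
    | .init => shape_cell _
    | .trans (.leftNil ..) => shape_feed nil wire _ _ nil_generated wire_generated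
    | .trans (.leftCons ..) => shape_feed (letter _) wire _ _ (letter_generated _) wire_generated
    | .trans (.rightNil ..) => shape_feed wire nil _ _ wire_generated nil_generated
    | .trans (.rightCons ..) => shape_feed wire (letter _) _ _ wire_generated (letter_generated _)
    | .finish _ => shape_cell _
  finite_oneCell := inferInstanceAs (Finite PUnit)
  finite_con := finite_letter
  finite_fun := finite_op
  finite_comp := finite_comp

/-- The 2-path of a word: the empty word is sent to `nil`, and `a w` to the 2-path of `w` followed
by the letter `a`. -/
def wordPath : List (Option A) → (sig A Q).poly2.Hom [] (W A Q)
  | [] => nil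
  | a :: w => (wordPath w).comp1 (letter a)

theorem wordPath_generated : (w : List (Option A)) →
    (wordPath (Q := Q) w).1.GeneratedBy (sig A Q).conCells
  | [] => nil_generated
  | a :: w => by
    change (Polygraph2.Path2.comp1 (wordPath w).1 (letter a).1
      ((wordPath w).2.2.trans (letter a).2.1.symm)).size _ = 0
    rw [Polygraph2.Path2.size_comp1]
    exact Nat.add_eq_zero_iff.mpr ⟨wordPath_generated w, letter_generated a⟩

variable [Finite A] [Finite Q]

/-- The value of type `w` that represents a word. -/
def word (w : List (Option A)) : M.program.Value (W A Q) := ⟨wordPath w, wordPath_generated w⟩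

/-- The 2-path `(w_l ⋆₀ w_r) ⋆₁ step q a` that represents the configuration `(q, a, w_l, w_r)`. -/
def encode (x : M.Config) : M.program.poly3.Path2 :=
  (feed (wordPath x.left) (wordPath x.right) x.state x.read).1

/-- The semantics of the main function 2-cell. -/
noncomputable def mainSem : M.program.Value (W A Q) →. M.program.Value (W A Q) :=
  PolygraphicProgram.sem (P := M.program) (main (A := A) (Q := Q))

/-- The 3-cell of the program that simulates one case of the definition of the transitions. -/
def ruleCell (r : M.Rule) : M.program.poly3.ThreeCell := Sum.inr (Comp.trans r)

/-- The 3-cell of the program that ends the computation. -/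
def finishCell (a : Option A) : M.program.poly3.ThreeCell := Sum.inr (Comp.finish a)

end TuringMachine

/-! A 2-path is a class of terms modulo exchange, so the reductions out of a configuration are not
visible on one chosen term. They are controlled by three tools.

Contexts and counting. An elementary 3-path applies one 3-cell with source `a` in a context `k ⋆₁ (u
⋆₀ a ⋆₀ v) ⋆₁ l` (`Path3.exists_isPlug`). The number of occurrences of a set of 2-cells is additive
and invariant under exchange. The source of every 3-cell contains exactly one 2-cell that is not a
constructor: a function for a computation 3-cell, a structure 2-cell otherwise. The 2-path of a
configuration contains exactly one non-constructor too, a function. Hence only a computation 3-cell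
applies to it, and the context is made of constructors.

Normal forms of constructor composites. Every such composite is a juxtaposition of columns, a column
being a wire that carries letters and is open or closed by `nil` at its top (`exists_columns`); when
the source is empty all columns are closed, and the composite is a juxtaposition of words.

Interpretation by trees. Constructors and functions act as formal symbols, structure 2-cells as
permutation, copy and deletion. The trees separate the juxtapositions of words and the
configurations. The tree of a configuration has a `step` at its root; a letter below the redex would
be at the root instead, so the redex is at the bottom and words are plugged into its inputs
(`exists_comp_of_reducesBy`). Reading off these words identifies the reduction with a transition or
with the final 3-cell (`stepBy_of_reducesBy`).

After the final 3-cell there remain constructors and at most one eraser. Only erasing 3-cells apply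
then; each of them lowers the number of 2-cells and preserves the tree, so that the right word is
the only normal form (`Erasing.reduces`, `Erasing.eq_or_reduces`). Such 2-paths are never
configurations, so a 3-path between configurations is a sequence of transitions. Since the machine
is deterministic and stops only in the final state, `main` applied to a word has a normal form
exactly when the machine halts, and then a unique one. -/

namespace Polygraph2

variable {P : Polygraph2.{u}}

/-! ### Algebra of 2-paths without composability side conditions -/

/-- Terms modulo associativity, local units and exchange, well-formed or not. -/
abbrev Cls (P : Polygraph2.{u}) : Type u := Quot (Term.Rel (P := P))

namespace Cls

/-- The 0-composition of classes of terms. -/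
def c0 : Cls P → Cls P → Cls P :=
  Quot.map₂ Term.comp0 (fun f _ _ h => Term.Rel.comp0_right f h)
    (fun _ _ g h => Term.Rel.comp0_left g h)

/-- The 1-composition of classes of terms. -/
def c1 : Cls P → Cls P → Cls P :=
  Quot.map₂ Term.comp1 (fun f _ _ h => Term.Rel.comp1_right f h)
    (fun _ _ g h => Term.Rel.comp1_left g h)

/-- The class of an identity. -/
def one (u : List P.OneCell) : Cls P := Quot.mk _ (Term.id u)

/-- The 1-source. -/
def src : Cls P → List P.OneCell := Quot.lift Term.src (fun _ _ h => h.src_eq)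

/-- The 1-target. -/
def tgt : Cls P → List P.OneCell := Quot.lift Term.tgt (fun _ _ h => h.tgt_eq)

@[simp] theorem src_one (u : List P.OneCell) : (one u).src = u := rfl
@[simp] theorem tgt_one (u : List P.OneCell) : (one u).tgt = u := rfl

@[simp] theorem src_c0 (x y : Cls P) : (c0 x y).src = x.src ++ y.src := by
  obtain ⟨x⟩ := x
  obtain ⟨y⟩ := y
  rfl

@[simp] theorem tgt_c0 (x y : Cls P) : (c0 x y).tgt = x.tgt ++ y.tgt := by
  obtain ⟨x⟩ := x
  obtain ⟨y⟩ := y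
  rfl

@[simp] theorem src_c1 (x y : Cls P) : (c1 x y).src = x.src := by
  obtain ⟨x⟩ := x
  obtain ⟨y⟩ := y
  rfl

@[simp] theorem tgt_c1 (x y : Cls P) : (c1 x y).tgt = y.tgt := by
  obtain ⟨x⟩ := x
  obtain ⟨y⟩ := y
  rfl

theorem c0_assoc (x y z : Cls P) : c0 (c0 x y) z = c0 x (c0 y z) := by
  obtain ⟨x⟩ := x
  obtain ⟨y⟩ := y
  obtain ⟨z⟩ := z
  exact Quot.sound (.assoc0 x y z)

theorem c1_assoc (x y z : Cls P) : c1 (c1 x y) z = c1 x (c1 y z) := by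
  obtain ⟨x⟩ := x
  obtain ⟨y⟩ := y
  obtain ⟨z⟩ := z
  exact Quot.sound (.assoc1 x y z)

theorem one_c0 (x : Cls P) : c0 (one []) x = x := by
  obtain ⟨x⟩ := x
  exact Quot.sound (.unit0_left x)

theorem c0_one (x : Cls P) : c0 x (one []) = x := by
  obtain ⟨x⟩ := x
  exact Quot.sound (.unit0_right x)

theorem one_c1 (x : Cls P) {u : List P.OneCell} (h : x.src = u) : c1 (one u) x = x := by
  subst h
  obtain ⟨x⟩ := x
  exact Quot.sound (.unit1_left x)

theorem c1_one (x : Cls P) {u : List P.OneCell} (h : x.tgt = u) : c1 x (one u) = x := by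
  subst h
  obtain ⟨x⟩ := x
  exact Quot.sound (.unit1_right x)

theorem one_c0_one (u v : List P.OneCell) : c0 (one u) (one v) = one (u ++ v) :=
  Quot.sound (.id_comp0 u v)

theorem exchange (x₁ x₂ y₁ y₂ : Cls P) (h₁ : x₁.tgt = y₁.src) (h₂ : x₂.tgt = y₂.src) :
    c1 (c0 x₁ x₂) (c0 y₁ y₂) = c0 (c1 x₁ y₁) (c1 x₂ y₂) := by
  obtain ⟨x₁⟩ := x₁
  obtain ⟨x₂⟩ := x₂
  obtain ⟨y₁⟩ := y₁
  obtain ⟨y₂⟩ := y₂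
  exact Quot.sound (.exchange x₁ x₂ y₁ y₂ h₁ h₂)

/-- Exchange, with `z` split as `z` followed by an identity. The whole of `z` stays in the upper
layer, and only wires accompany `y`. -/
theorem c0_c1 (z x y : Cls P) (h : x.tgt = y.src) :
    c0 z (c1 x y) = c1 (c0 z x) (c0 (one z.tgt) y) := by
  rw [exchange _ _ _ _ rfl h, c1_one z rfl]

theorem c1_c0 (z x y : Cls P) (h : x.tgt = y.src) :
    c0 (c1 x y) z = c1 (c0 x z) (c0 y (one z.tgt)) := by
  rw [exchange _ _ _ _ h rfl, c1_one z rfl]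

/-- Moving a 2-path down along a juxtaposition of three. -/
theorem slide (x y z a b l : Cls P) {u v : List P.OneCell} (hx : x.tgt = u) (hy : y.tgt = v)
    (hz : z.tgt = a.src) (hab : a.tgt = b.src) :
    c1 (c0 x (c0 (c1 z a) y)) (c1 (c0 (one u) (c0 b (one v))) l) =
      c1 (c0 x (c0 z y)) (c1 (c0 (one u) (c0 (c1 a b) (one v))) l) := by
  rw [c1_c0 (one v) a b hab, c0_c1 (one u) _ _ (by simp [hab]), tgt_one, tgt_one, ← c1_assoc,
    ← c1_assoc, ← c1_assoc, exchange x (c0 z y) (one u) (c0 a (one v)) hx (by simp [hz, hy]),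
    exchange z y a (one v) hz hy,
    c1_one x hx, c1_one y hy]

end Cls

open Cls

namespace Path2

/-- The class of a 2-path. -/
def cls (f : P.Path2) : Cls P := f.1

theorem cls_injective : Function.Injective (cls (P := P)) := Subtype.val_injective

@[simp] theorem cls_comp0 (f g : P.Path2) : (f.comp0 g).cls = c0 f.cls g.cls := rfl

@[simp] theorem cls_comp1 (f g : P.Path2) (h : f.tgt = g.src) :
    (f.comp1 g h).cls = c1 f.cls g.cls := rfl

@[simp] theorem cls_id (u : List P.OneCell) : (id u : P.Path2).cls = one u := rfl

@[simp] theorem src_cls (f : P.Path2) : f.cls.src = f.src := rfl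

@[simp] theorem tgt_cls (f : P.Path2) : f.cls.tgt = f.tgt := rfl

@[simp] theorem src_id (u : List P.OneCell) : (id u : P.Path2).src = u := rfl
@[simp] theorem tgt_id (u : List P.OneCell) : (id u : P.Path2).tgt = u := rfl
@[simp] theorem size_id (X : Set P.TwoCell) (u : List P.OneCell) : (id u : P.Path2).size X = 0 :=
  rfl

open Classical in
theorem size_cell (X : Set P.TwoCell) (φ : P.TwoCell) :
    (cell φ : P.Path2).size X = if φ ∈ X then 1 else 0 := rfl

@[simp] theorem comp1_id (f : P.Path2) (u : List P.OneCell) (h : f.tgt = (id u : P.Path2).src) :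
    f.comp1 (id u) h = f :=
  cls_injective (c1_one f.cls h)

/-- Induction on 2-paths. -/
theorem induction {p : P.Path2 → Prop} (id : ∀ u, p (id u)) (cell : ∀ φ, p (cell φ))
    (comp0 : ∀ f g, p f → p g → p (f.comp0 g))
    (comp1 : ∀ f g h, p f → p g → p (f.comp1 g h)) (f : P.Path2) : p f := by
  obtain ⟨⟨t⟩, ht⟩ := f
  change t.WF at ht
  induction t with
  | id u => exact id u
  | cell φ => exact cell φ
  | comp0 f g hf hg => exact comp0 ⟨Quot.mk _ f, ht.1⟩ ⟨Quot.mk _ g, ht.2⟩ (hf ht.1) (hg ht.2)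
  | comp1 f g hf hg =>
    exact comp1 ⟨Quot.mk _ f, ht.1⟩ ⟨Quot.mk _ g, ht.2.1⟩ ht.2.2 (hf ht.1) (hg ht.2.1)

theorem size_mono {X Y : Set P.TwoCell} (h : X ⊆ Y) (f : P.Path2) : f.size X ≤ f.size Y := by
  classical
  induction f using induction with
  | id u => simp
  | cell φ =>
    simp only [size_cell]
    split_ifs <;> simp_all [Set.subset_def]
  | comp0 f g hf hg =>
    rw [size_comp0, size_comp0]
    omega
  | comp1 f g h hf hg =>
    rw [size_comp1, size_comp1]
    omega

/-- Disjoint subsets of `Z` count different occurrences. This excludes erasers from the source of a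
computation 3-cell, whose only non-constructor is a function. -/
theorem size_add_le {X Y Z : Set P.TwoCell} (hXY : ∀ φ ∈ X, φ ∉ Y) (hX : X ⊆ Z) (hY : Y ⊆ Z)
    (f : P.Path2) : f.size X + f.size Y ≤ f.size Z := by
  classical
  induction f using induction with
  | id u => simp
  | cell φ =>
    have h₁ := hXY φ
    have h₂ := @hX φ
    have h₃ := @hY φ
    simp only [size_cell]
    split_ifs <;> simp_all
  | comp0 f g hf hg =>
    simp only [size_comp0]
    omega
  | comp1 f g h hf hg =>
    simp only [size_comp1]
    omega

end Path2

/-! ### Plugging a 2-path into a context -/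

/-- `f = k ⋆₁ (u ⋆₀ a ⋆₀ v) ⋆₁ l`. -/
structure IsPlug (k : P.Path2) (u v : List P.OneCell) (l a f : P.Path2) : Prop where
  src_eq : u ++ (a.src ++ v) = k.tgt
  tgt_eq : u ++ (a.tgt ++ v) = l.src
  cls_eq : f.cls = c1 k.cls (c1 (c0 (one u) (c0 a.cls (one v))) l.cls)

namespace IsPlug

variable {k l a f : P.Path2} {u v : List P.OneCell}

theorem refl (a : P.Path2) {x y : List P.OneCell} (hx : a.src = x) (hy : a.tgt = y) :
    IsPlug (.id x) [] [] (.id y) a a where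
  src_eq := by simp [hx]
  tgt_eq := by simp [hy]
  cls_eq := by
    rw [c0_one, one_c0, Path2.cls_id, Path2.cls_id, c1_one a.cls hy, one_c1 a.cls hx]

theorem eq (h : IsPlug k u v l a f) :
    f = k.comp1 (((Path2.id u).comp0 (a.comp0 (.id v))).comp1 l
      (by simp [Path2.tgt_comp0, h.tgt_eq])) (by
        simp [Path2.src_comp1, Path2.src_comp0, h.src_eq]) :=
  Path2.cls_injective h.cls_eq

theorem src_path (h : IsPlug k u v l a f) : f.src = k.src := by
  rw [h.eq, Path2.src_comp1]

theorem tgt_path (h : IsPlug k u v l a f) : f.tgt = l.tgt := by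
  rw [h.eq, Path2.tgt_comp1, Path2.tgt_comp1]

theorem size_path (h : IsPlug k u v l a f) (X : Set P.TwoCell) :
    f.size X = k.size X + a.size X + l.size X := by
  rw [h.eq, Path2.size_comp1, Path2.size_comp1, Path2.size_comp0, Path2.size_comp0,
    Path2.size_id, Path2.size_id]
  omega

theorem comp1_left (g : P.Path2) (hg : g.tgt = f.src) (h : IsPlug k u v l a f) :
    IsPlug (g.comp1 k (hg.trans h.src_path)) u v l a (g.comp1 f hg) where
  src_eq := by rw [Path2.tgt_comp1, h.src_eq]
  tgt_eq := h.tgt_eq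
  cls_eq := by rw [Path2.cls_comp1, Path2.cls_comp1, h.cls_eq, c1_assoc]

theorem comp1_right (g : P.Path2) (hg : f.tgt = g.src) (h : IsPlug k u v l a f) :
    IsPlug k u v (l.comp1 g (h.tgt_path.symm.trans hg)) a (f.comp1 g hg) where
  src_eq := h.src_eq
  tgt_eq := by rw [Path2.src_comp1, h.tgt_eq]
  cls_eq := by simp only [Path2.cls_comp1, h.cls_eq, c1_assoc]

/-- The shape of contexts is stable under juxtaposition: by exchange `g` is done entirely above `a`,
in the part `k`, and only its output wires run beside `a` and `l`. Since these data depend on `g`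
alone, the same context serves the source and the target of a 3-cell. -/
theorem comp0_left (g : P.Path2) (h : IsPlug k u v l a f) :
    IsPlug (g.comp0 k) (g.tgt ++ u) v ((Path2.id g.tgt).comp0 l) a (g.comp0 f) where
  src_eq := by rw [Path2.tgt_comp0, ← h.src_eq, List.append_assoc]
  tgt_eq := by rw [Path2.src_comp0, ← h.tgt_eq, List.append_assoc, Path2.src_id]
  cls_eq := by
    have e₁ := h.src_eq
    have e₂ := h.tgt_eq
    simp only [Path2.cls_comp0, h.cls_eq]
    rw [c0_c1 _ _ _ (by simpa using e₁.symm), c0_c1 _ _ _ (by simpa using e₂),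
      ← c0_assoc (one _) (one u), one_c0_one, Path2.tgt_cls, Path2.cls_id, tgt_one]

theorem comp0_right (g : P.Path2) (h : IsPlug k u v l a f) :
    IsPlug (k.comp0 g) u (v ++ g.tgt) (l.comp0 (.id g.tgt)) a (f.comp0 g) where
  src_eq := by rw [Path2.tgt_comp0, ← h.src_eq]; simp
  tgt_eq := by rw [Path2.src_comp0, ← h.tgt_eq]; simp
  cls_eq := by
    have e₁ := h.src_eq
    have e₂ := h.tgt_eq
    simp only [Path2.cls_comp0, h.cls_eq]
    rw [c1_c0 _ _ _ (by simpa using e₁.symm), c1_c0 _ _ _ (by simpa using e₂)]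
    simp only [c0_assoc, one_c0_one, Path2.tgt_cls, Path2.cls_id, tgt_one]

end IsPlug

/-- A 2-path that contains a cell of `X` can be decomposed around it. -/
theorem Path2.exists_isPlug_cell (X : Set P.TwoCell) (f : P.Path2) (hf : f.size X ≠ 0) :
    ∃ φ ∈ X, ∃ k u v l, IsPlug k u v l (cell φ) f := by
  induction f using induction with
  | id u => simp at hf
  | cell φ =>
    rw [size_cell] at hf
    exact ⟨φ, by simpa using hf, _, _, _, _, .refl _ rfl rfl⟩
  | comp0 f g ihf ihg =>
    rw [size_comp0] at hf
    by_cases h : f.size X = 0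
    · obtain ⟨φ, hφ, k, u, v, l, H⟩ := ihg (by omega)
      exact ⟨φ, hφ, _, _, _, _, H.comp0_left f⟩
    · obtain ⟨φ, hφ, k, u, v, l, H⟩ := ihf h
      exact ⟨φ, hφ, _, _, _, _, H.comp0_right g⟩
  | comp1 f g e ihf ihg =>
    rw [size_comp1] at hf
    by_cases h : f.size X = 0
    · obtain ⟨φ, hφ, k, u, v, l, H⟩ := ihg (by omega)
      exact ⟨φ, hφ, _, _, _, _, H.comp1_left f e⟩
    · obtain ⟨φ, hφ, k, u, v, l, H⟩ := ihf h
      exact ⟨φ, hφ, _, _, _, _, H.comp1_right g e⟩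

/-! ### Interpretation of 2-paths as maps -/

/-- An interpretation of the 2-cells as maps between powers of `X`. -/
structure Model (P : Polygraph2.{u}) (X : Type u) where
  app : P.TwoCell → List X → List X
  length_app : ∀ φ xs, xs.length = (P.source φ).length →
    (app φ xs).length = (P.target φ).length

namespace Model

variable {X : Type u} (m : Model P X)

/-- The interpretation of a term. -/
def interpTerm : P.Term → List X → List X
  | .id _, xs => xs
  | .cell φ, xs => m.app φ xs
  | .comp0 f g, xs => interpTerm f (xs.take f.src.length) ++ interpTerm g (xs.drop f.src.length)
  | .comp1 f g, xs => interpTerm g (interpTerm f xs)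

theorem length_interpTerm (f : P.Term) (hf : f.WF) (xs : List X) (h : xs.length = f.src.length) :
    (m.interpTerm f xs).length = f.tgt.length := by
  induction f generalizing xs with
  | id u => exact h
  | cell φ => exact m.length_app φ xs h
  | comp0 f g ihf ihg =>
    simp only [Term.src, List.length_append] at h
    simp only [interpTerm, Term.tgt, List.length_append]
    rw [ihf hf.1 _ (by simp; omega), ihg hf.2 _ (by simp; omega)]
  | comp1 f g ihf ihg =>
    exact ihg hf.2.1 _ (by rw [ihf hf.1 _ h, hf.2.2])

/-- Juxtaposition cuts the input at the source length of its first factor. In the exchange relation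
the two sides cut at the same place because a well-formed term maps lists of its source length to
lists of its target length; hence both hypotheses. -/
theorem interpTerm_rel {f g : P.Term} (r : Term.Rel f g) (hf : f.WF) (xs : List X)
    (h : xs.length = f.src.length) : m.interpTerm f xs = m.interpTerm g xs := by
  induction r generalizing xs with
  | assoc0 f g h' =>
    simp [interpTerm, Term.src, List.take_take, List.drop_take]
  | assoc1 => rfl
  | unit0_left => simp [interpTerm, Term.src]
  | unit0_right f =>
    simp only [Term.src, List.append_nil] at h
    simp [interpTerm, ← h]
  | unit1_left => rfl
  | unit1_right => rfl
  | id_comp0 => simp [interpTerm]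
  | exchange f₁ f₂ g₁ g₂ h₁ h₂ =>
    simp only [Term.src, List.length_append] at h
    have e := m.length_interpTerm f₁ hf.1.1 (xs.take f₁.src.length) (by simp; omega)
    rw [h₁] at e
    simp [interpTerm, Term.src, ← e]
  | comp0_left g r ih =>
    simp only [Term.src, List.length_append] at h
    simp only [interpTerm, ← r.src_eq]
    rw [ih hf.1 _ (by simp; omega)]
  | comp0_right f r ih =>
    simp only [Term.src, List.length_append] at h
    simp only [interpTerm]
    rw [ih hf.2 _ (by simp; omega)]
  | comp1_left g r ih =>
    simp only [interpTerm]
    rw [ih hf.1 _ h]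
  | comp1_right f r ih =>
    simp only [interpTerm]
    rw [ih hf.2.1 _ (by rw [m.length_interpTerm f hf.1 _ h, hf.2.2])]

open Classical in
/-- The interpretation of a 2-path. -/
noncomputable def eval (f : P.Path2) (xs : List X) : List X :=
  -- The quotient also contains ill-formed terms, on which the relations need not preserve the
  -- interpretation. There, and on lists of the wrong length, the value is `[]`; the test itself is
  -- invariant under the relations.
  Quot.lift (fun t : P.Term => if t.WF ∧ xs.length = t.src.length then m.interpTerm t xs else [])
    (fun f g r => by
      simp only [← r.wf_eq, ← r.src_eq]
      split_ifs with h
      · exact m.interpTerm_rel r h.1 xs h.2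
      · rfl) f.1

theorem eval_mk (t : P.Term) (ht : t.WF) (xs : List X) (h : xs.length = t.src.length) :
    m.eval ⟨Quot.mk _ t, ht⟩ xs = m.interpTerm t xs :=
  if_pos ⟨ht, h⟩

theorem length_eval (f : P.Path2) (xs : List X) (h : xs.length = f.src.length) :
    (m.eval f xs).length = f.tgt.length := by
  obtain ⟨⟨t⟩, ht⟩ := f
  exact (congrArg _ (m.eval_mk t ht xs h)).trans (m.length_interpTerm t ht xs h)

theorem eval_id (u : List P.OneCell) (xs : List X) (h : xs.length = u.length) :
    m.eval (.id u) xs = xs :=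
  m.eval_mk _ _ _ h

theorem eval_cell (φ : P.TwoCell) (xs : List X) (h : xs.length = (P.source φ).length) :
    m.eval (.cell φ) xs = m.app φ xs :=
  m.eval_mk (.cell φ) trivial _ h

theorem eval_comp0 (f g : P.Path2) (xs ys : List X) (hx : xs.length = f.src.length)
    (hy : ys.length = g.src.length) :
    m.eval (f.comp0 g) (xs ++ ys) = m.eval f xs ++ m.eval g ys := by
  obtain ⟨⟨f⟩, hf⟩ := f
  obtain ⟨⟨g⟩, hg⟩ := g
  refine (m.eval_mk (.comp0 f g) ⟨hf, hg⟩ _ ?_).trans ?_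
  · change _ = (f.src ++ g.src).length
    rw [List.length_append, List.length_append]
    exact congrArg₂ _ hx hy
  · change xs.length = f.src.length at hx
    rw [interpTerm, ← hx, List.take_left, List.drop_left]
    exact congrArg₂ _ (m.eval_mk f hf _ hx).symm (m.eval_mk g hg _ hy).symm

theorem eval_comp1 (f g : P.Path2) (h : f.tgt = g.src) (xs : List X)
    (hx : xs.length = f.src.length) : m.eval (f.comp1 g h) xs = m.eval g (m.eval f xs) := by
  have e := m.length_eval f xs hx
  obtain ⟨⟨f⟩, hf⟩ := f
  obtain ⟨⟨g⟩, hg⟩ := g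
  refine (m.eval_mk (.comp1 f g) ⟨hf, hg, h⟩ _ hx).trans ?_
  refine (Eq.trans (m.eval_mk g hg _ (e.trans (congrArg _ h))) ?_).symm
  exact congrArg _ (m.eval_mk f hf _ hx)

/-- Two 2-paths with the same interpretation can be exchanged in a context. -/
theorem eval_eq_of_isPlug {k l a b f g : P.Path2} {u v : List P.OneCell}
    (hf : IsPlug k u v l a f) (hg : IsPlug k u v l b g)
    (hs : a.src = b.src)
    (hab : ∀ ys, ys.length = a.src.length → m.eval a ys = m.eval b ys)
    (xs : List X) (hx : xs.length = f.src.length) : m.eval f xs = m.eval g xs := by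
  have hk : xs.length = k.src.length := by rw [hx, hf.src_path]
  -- The output of `k` is cut into what runs on `u`, what enters `a`, and what runs on `v`.
  obtain ⟨x₁, x₂, x₃, e, h₁, h₂, h₃⟩ : ∃ x₁ x₂ x₃, m.eval k xs = x₁ ++ (x₂ ++ x₃) ∧
      x₁.length = u.length ∧ x₂.length = a.src.length ∧ x₃.length = v.length := by
    have := m.length_eval k xs hk
    rw [← hf.src_eq] at this
    simp only [List.length_append] at this
    exact ⟨(m.eval k xs).take u.length, ((m.eval k xs).drop u.length).take a.src.length,
      ((m.eval k xs).drop u.length).drop a.src.length, by simp [List.take_append_drop],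
      by simp; omega,
      by simp; omega, by simp; omega⟩
  have key : ∀ {c h : P.Path2}, IsPlug k u v l c h → c.src = a.src →
      m.eval h xs = m.eval l (x₁ ++ (m.eval c x₂ ++ x₃)) := by
    intro c h hh hc
    have hl : (x₂ ++ x₃).length = (c.comp0 (.id v)).src.length := by
      simp [Path2.src_comp0, hc, h₂, h₃]
    rw [hh.eq, m.eval_comp1 _ _ _ _ hk, e, m.eval_comp1, m.eval_comp0 _ _ _ _ h₁ hl,
      m.eval_comp0 _ _ _ _ (by rw [h₂, hc]) h₃, m.eval_id _ _ h₁, m.eval_id _ _ h₃]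
    rw [Path2.src_comp0, List.length_append, List.length_append (as := (Path2.id u).src), ← hl,
      Path2.src_id, h₁]
  rw [key hf rfl, key hg hs.symm, hab _ h₂]

end Model

end Polygraph2

/-! ### Elementary 3-paths and sequentialization -/

namespace Polygraph3

variable {P : Polygraph3.{u}}

open Polygraph2

theorem Path3.parallel {f g : P.Path2} (F : P.Path3 f g) : f.src = g.src ∧ f.tgt = g.tgt := by
  induction F with
  | id f => exact ⟨rfl, rfl⟩
  | cell α => exact ⟨(P.source3 α).2.1.trans (P.target3 α).2.1.symm,
      (P.source3 α).2.2.trans (P.target3 α).2.2.symm⟩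
  | comp0 F G hF hG => simp [Path2.src_comp0, Path2.tgt_comp0, hF, hG]
  | comp1 h h' F G hF hG => simp [Path2.src_comp1, Path2.tgt_comp1, hF, hG]
  | comp2 F G hF hG => exact ⟨hF.1.trans hG.1, hF.2.trans hG.2⟩

/-- Without 3-cells a formal composite is built from degenerate 3-paths only. -/
theorem Path3.eq_of_size {f g : P.Path2} (F : P.Path3 f g) (h : F.size Set.univ = 0) :
    f = g := by
  induction F with
  | id f => rfl
  | cell α => simp [size] at h
  | comp0 F G hF hG =>
    simp only [size, Nat.add_eq_zero_iff] at h
    rw [hF h.1, hG h.2]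
  | comp1 _ _ F G hF hG =>
    simp only [size, Nat.add_eq_zero_iff] at h
    obtain rfl := hF h.1
    obtain rfl := hG h.2
    rfl
  | comp2 F G hF hG =>
    simp only [size, Nat.add_eq_zero_iff] at h
    rw [hF h.1, hG h.2]

theorem Path3.size_mono {X Y : Set P.ThreeCell} (hXY : X ⊆ Y) {f g : P.Path2}
    (F : P.Path3 f g) : F.size X ≤ F.size Y := by
  induction F with
  | id f => exact le_rfl
  | cell α =>
    simp only [size]
    split_ifs <;> simp_all [Set.subset_def]
  | comp0 F G hF hG => exact Nat.add_le_add hF hG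
  | comp1 _ _ F G hF hG => exact Nat.add_le_add hF hG
  | comp2 F G hF hG => exact Nat.add_le_add hF hG

/-- An elementary 3-path applies a 3-cell in a context. -/
theorem Path3.exists_isPlug {f g : P.Path2} (F : P.Path3 f g) (h : F.size Set.univ = 1) :
    ∃ α, (∀ β, F.size {β} = 1 → β = α) ∧ F.size {α} = 1 ∧ ∃ k u v l,
      IsPlug k u v l (P.source3 α).1 f ∧ IsPlug k u v l (P.target3 α).1 g := by
  -- A factor without 3-cells contributes nothing to the count of any single 3-cell, so the factor
  -- that contains the 3-cell decides which one it is.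
  have zero : ∀ {f g : P.Path2} (F : P.Path3 f g), F.size Set.univ = 0 → ∀ X, F.size X = 0 :=
    fun F h X => Nat.le_zero.mp (h ▸ F.size_mono (Set.subset_univ X))
  induction F with
  | id f => simp [size] at h
  | cell α =>
    refine ⟨α, fun β hβ => ?_, by simp [size], _, _, _, _,
      .refl _ (P.source3 α).2.1 (P.source3 α).2.2, .refl _ (P.target3 α).2.1 (P.target3 α).2.2⟩
    by_contra hne
    simp [size, Ne.symm hne] at hβ
  | @comp0 f f' g g' F G hF hG =>
    simp only [size] at h ⊢
    -- Exactly one factor contains the 3-cell. The other has equal source and target, and is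
    -- absorbed in the context.
    by_cases h0 : F.size Set.univ = 0
    · obtain rfl := F.eq_of_size h0
      obtain ⟨α, h₁, h₂, k, u, v, l, H, H'⟩ := hG (by omega)
      simp only [zero F h0, Nat.zero_add]
      exact ⟨α, h₁, h₂, _, _, _, _, H.comp0_left f, H'.comp0_left f⟩
    · have h0' : G.size Set.univ = 0 := by omega
      obtain rfl := G.eq_of_size h0'
      obtain ⟨α, h₁, h₂, k, u, v, l, H, H'⟩ := hF (by omega)
      simp only [zero G h0', Nat.add_zero]
      exact ⟨α, h₁, h₂, _, _, _, _, H.comp0_right g, H'.comp0_right g⟩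
  | @comp1 f f' g g' e e' F G hF hG =>
    simp only [size] at h ⊢
    by_cases h0 : F.size Set.univ = 0
    · obtain rfl := F.eq_of_size h0
      obtain ⟨α, h₁, h₂, k, u, v, l, H, H'⟩ := hG (by omega)
      simp only [zero F h0, Nat.zero_add]
      exact ⟨α, h₁, h₂, _, _, _, _, H.comp1_left f e, H'.comp1_left f e'⟩
    · have h0' : G.size Set.univ = 0 := by omega
      obtain rfl := G.eq_of_size h0'
      obtain ⟨α, h₁, h₂, k, u, v, l, H, H'⟩ := hF (by omega)
      simp only [zero G h0', Nat.add_zero]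
      exact ⟨α, h₁, h₂, _, _, _, _, H.comp1_right g e, H'.comp1_right g e'⟩
  | @comp2 f g i F G hF hG =>
    simp only [size] at h ⊢
    by_cases h0 : F.size Set.univ = 0
    · obtain rfl := F.eq_of_size h0
      obtain ⟨α, h₁, h₂, H⟩ := hG (by omega)
      simp only [zero F h0, Nat.zero_add]
      exact ⟨α, h₁, h₂, H⟩
    · have h0' : G.size Set.univ = 0 := by omega
      obtain rfl := G.eq_of_size h0'
      obtain ⟨α, h₁, h₂, H⟩ := hF (by omega)
      simp only [zero G h0', Nat.add_zero]
      exact ⟨α, h₁, h₂, H⟩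

/-- This turns the existence of a 3-path into two equations between 2-paths in one common context,
to which counting and interpretation apply. -/
theorem reducesBy_iff {α : P.ThreeCell} {f g : P.Path2} :
    ReducesBy α f g ↔ ∃ k u v l,
      IsPlug k u v l (P.source3 α).1 f ∧ IsPlug k u v l (P.target3 α).1 g := by
  constructor
  · rintro ⟨F, h, hα⟩
    obtain ⟨β, h₁, h₂, H⟩ := F.exists_isPlug h
    obtain rfl := h₁ α hα
    exact H
  · rintro ⟨k, u, v, l, H, H'⟩
    rw [H.eq, H'.eq]
    exact ⟨.comp1 _ _ (.id k) (.comp1 _ _ (.comp0 (.id _) (.comp0 (.cell α) (.id _))) (.id l)),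
      by simp [Path3.size], by simp [Path3.size]⟩

theorem reduces_iff {f g : P.Path2} : Reduces f g ↔ ∃ α, ReducesBy α f g := by
  constructor
  · rintro ⟨F, h⟩
    obtain ⟨α, -, h₂, -⟩ := F.exists_isPlug h
    exact ⟨α, F, h, h₂⟩
  · rintro ⟨α, F, h, -⟩
    exact ⟨F, h⟩

/-- A composite in dimension 0 or 1 is made sequential: the first factor is executed while the
second one waits at its source, then the second while the first one waits at its target. -/
theorem hasPath_iff {f g : P.Path2} : HasPath f g ↔ Relation.ReflTransGen Reduces f g := by
  constructor
  · rintro ⟨F⟩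
    induction F with
    | id f => exact .refl
    | cell α => exact .single ⟨.cell α, by simp [Path3.size]⟩
    | @comp0 f f' g g' F G hF hG =>
      refine (hF.lift (fun x => x.comp0 g) ?_).trans (hG.lift (fun x => f'.comp0 x) ?_)
      · rintro x y ⟨H, h⟩
        exact ⟨.comp0 H (.id g), by simpa [Path3.size] using h⟩
      · rintro x y ⟨H, h⟩
        exact ⟨.comp0 (.id f') H, by simpa [Path3.size] using h⟩
    | @comp1 f f' g g' e e' F G hF hG =>
      -- The composability proof is part of the 1-composite. It is transported along the reductions,
      -- which preserve 1-sources and 1-targets.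
      have h₁ : ∀ x, Relation.ReflTransGen Reduces f x → ∃ h : x.tgt = g.src,
          Relation.ReflTransGen Reduces (f.comp1 g e) (x.comp1 g h) := by
        intro x hx
        induction hx with
        | refl => exact ⟨e, .refl⟩
        | tail _ r ih =>
          obtain ⟨h, ih⟩ := ih
          obtain ⟨H, hH⟩ := r
          exact ⟨H.parallel.2.symm.trans h, ih.tail ⟨.comp1 _ _ H (.id g), by
            simpa [Path3.size] using hH⟩⟩
      have h₂ : ∀ x, Relation.ReflTransGen Reduces g x → ∀ h : f'.tgt = g.src,
          ∃ h' : f'.tgt = x.src,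
          Relation.ReflTransGen Reduces (f'.comp1 g h) (f'.comp1 x h') := by
        intro x hx h
        induction hx with
        | refl => exact ⟨h, .refl⟩
        | tail _ r ih =>
          obtain ⟨h, ih⟩ := ih
          obtain ⟨H, hH⟩ := r
          exact ⟨h.trans H.parallel.1, ih.tail ⟨.comp1 _ _ (.id f') H, by
            simpa [Path3.size] using hH⟩⟩
      obtain ⟨h, r₁⟩ := h₁ _ hF
      obtain ⟨_, q⟩ := h₂ _ hG h
      exact r₁.trans q
    | comp2 F G hF hG => exact hF.trans hG
  · intro h
    induction h with
    | refl => exact ⟨.id _⟩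
    | tail _ r ih =>
      obtain ⟨F⟩ := ih
      obtain ⟨G, -⟩ := r
      exact ⟨.comp2 F G⟩

end Polygraph3

/-! ### The tree interpretation of the program -/

namespace TuringMachine

open Polygraph2

variable {A Q : Type u}

/-- Formal results of the evaluation of constructors and functions. -/
inductive Tree (A Q : Type u) : Type u
  | nil : Tree A Q
  | letter (a : Option A) (s : Tree A Q) : Tree A Q
  | main (s : Tree A Q) : Tree A Q
  | step (q : Q) (a : Option A) (s t : Tree A Q) : Tree A Q

/-- The action of a 2-cell on trees. -/
def cellApp : (sig A Q).Cell → List (Tree A Q) → List (Tree A Q)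
  | .swap _ _, [s, t] => [t, s]
  | .dup _, [s] => [s, s]
  | .erase _, _ => []
  | .con Letter.nil, _ => [.nil]
  | .con (Letter.letter a), [s] => [.letter a s]
  | .func Op.main, [s] => [.main s]
  | .func (Op.step q a), [s, t] => [.step q a s t]
  -- Reached only on lists whose length is not that of the 1-source.
  | _, _ => []

/-- The interpretation of 2-paths as maps between lists of trees. -/
def treeModel (A Q : Type u) : Model (sig A Q).poly2 (Tree A Q) where
  app := cellApp
  length_app φ xs h := by
    rcases φ with ⟨ξ, ζ⟩ | ξ | ξ | (_ | a) | (_ | ⟨q, a⟩)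
    · obtain ⟨s, t, rfl⟩ := List.length_eq_two.mp h
      rfl
    · obtain ⟨s, rfl⟩ := List.length_eq_one_iff.mp h
      rfl
    · rfl
    · rfl
    · obtain ⟨s, rfl⟩ := List.length_eq_one_iff.mp h
      rfl
    · obtain ⟨s, rfl⟩ := List.length_eq_one_iff.mp h
      rfl
    · obtain ⟨s, t, rfl⟩ := List.length_eq_two.mp h
      rfl

/-- Letters on top of a tree. -/
def addLetters (w : List (Option A)) (t : Tree A Q) : Tree A Q := w.foldr .letter t

@[simp] theorem addLetters_nil (t : Tree A Q) : addLetters [] t = t := rfl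

@[simp] theorem addLetters_cons (a : Option A) (w : List (Option A)) (t : Tree A Q) :
    addLetters (a :: w) t = .letter a (addLetters w t) := rfl

/-- The tree of a word. -/
abbrev wordTree (w : List (Option A)) : Tree A Q := addLetters w .nil

theorem wordTree_injective : Function.Injective (wordTree : List (Option A) → Tree A Q) := by
  intro v w h
  induction v generalizing w with
  | nil => cases w <;> simp_all
  | cons a v ih =>
    cases w with
    | nil => simp at h
    | cons b w =>
      simp only [addLetters_cons, Tree.letter.injEq] at h
      rw [h.1, ih h.2]

/-- There is a single 1-cell, so composability is a matter of counting wires. -/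
theorem onePath_ext {u v : List (sig A Q).poly2.OneCell} (h : u.length = v.length) : u = v :=
  List.ext_getElem h fun _ _ _ => rfl

/-! ### Composites of constructors -/

/-- The source of a column. -/
def columnSource (A Q : Type u) : Bool → List (sig A Q).poly2.OneCell
  | true => []
  | false => [PUnit.unit]

/-- A wire that carries letters; it is either closed by `nil` or open. -/
def column : (b : Bool) → List (Option A) → (sig A Q).poly2.Hom (columnSource A Q b) (W A Q)
  | true, [] => nil
  | false, [] => wire
  | b, a :: w => (column b w).comp1 (letter a)

/-- Juxtaposition of columns. -/
def columns : List (Bool × List (Option A)) → (sig A Q).poly2.Path2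
  | [] => .id []
  | c :: cs => (column c.1 c.2).1.comp0 (columns cs)

@[simp] theorem columns_nil : columns (Q := Q) ([] : List (Bool × List (Option A))) = .id [] := rfl

@[simp] theorem columns_cons (c : Bool × List (Option A)) (cs : List (Bool × List (Option A))) :
    columns (Q := Q) (c :: cs) = (column c.1 c.2).1.comp0 (columns cs) := rfl

@[simp] theorem src_column (b : Bool) (w : List (Option A)) :
    (column (Q := Q) b w).1.src = columnSource A Q b := (column b w).2.1

@[simp] theorem tgt_column (b : Bool) (w : List (Option A)) :
    (column (Q := Q) b w).1.tgt = columnSource A Q false := (column b w).2.2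

theorem columnSource_true : columnSource A Q true = [] := rfl

@[simp] theorem length_columnSource_false : (columnSource A Q false).length = 1 := rfl

theorem src_columns (cs : List (Bool × List (Option A))) :
    (columns (Q := Q) cs).src = cs.flatMap fun c => columnSource A Q c.1 := by
  induction cs with
  | nil => rfl
  | cons c cs ih => rw [columns_cons, Path2.src_comp0, ih, src_column, List.flatMap_cons]

theorem length_tgt_columns (cs : List (Bool × List (Option A))) :
    (columns (Q := Q) cs).tgt.length = cs.length := by
  induction cs with
  | nil => rfl
  | cons c cs ih =>
    rw [columns_cons, Path2.tgt_comp0, tgt_column, List.length_append, ih,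
      length_columnSource_false, List.length_cons, Nat.add_comm]

theorem columns_append (cs ds : List (Bool × List (Option A))) :
    columns (Q := Q) (cs ++ ds) = (columns cs).comp0 (columns ds) := by
  apply Path2.cls_injective
  induction cs with
  | nil => simp [Cls.one_c0]
  | cons c cs ih => simp [Cls.c0_assoc, ih]

theorem cls_column_cons (b : Bool) (a : Option A) (w : List (Option A)) :
    (column (Q := Q) b (a :: w)).1.cls = Cls.c1 (column b w).1.cls (letter a).1.cls := by
  cases b <;> rfl

theorem cls_column_append (b : Bool) (w v : List (Option A)) :
    Cls.c1 (column (Q := Q) b v).1.cls (column false w).1.cls = (column b (w ++ v)).1.cls := by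
  induction w with
  | nil => exact Cls.c1_one _ (tgt_column b v)
  | cons a w ih =>
    rw [cls_column_cons, ← Cls.c1_assoc, ih, List.cons_append, cls_column_cons]

/-- Induction on the lower row. A closed column there has no input and is inserted beside the upper
row; an open one is stacked under the first upper column, which exists because the numbers of wires
agree. -/
theorem exists_columns_comp1 (cs ds : List (Bool × List (Option A)))
    (h : (columns (Q := Q) cs).tgt = (columns ds).src) :
    ∃ es, (columns (Q := Q) cs).comp1 (columns ds) h = columns es := by
  induction ds generalizing cs with
  | nil =>
    exact ⟨cs, Path2.comp1_id _ _ _⟩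
  | cons d ds ih =>
    have h' := congrArg List.length h
    obtain ⟨b, w⟩ := d
    cases b with
    | true =>
      have e : (columns (Q := Q) cs).tgt = (columns ds).src := by
        apply onePath_ext
        rw [h', columns_cons, Path2.src_comp0, src_column, columnSource_true, List.nil_append]
      obtain ⟨es, hes⟩ := ih cs e
      refine ⟨(true, w) :: es, Path2.cls_injective ?_⟩
      -- An empty 1-path is put above the closed column so that exchange applies.
      rw [Path2.cls_comp1, ← Cls.one_c0 (columns cs).cls, columns_cons, Path2.cls_comp0,
        Cls.exchange (Cls.one []) (columns cs).cls (column true w).1.cls (columns ds).cls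
          (src_column true w).symm e,
        Cls.one_c1 (u := []) (column true w).1.cls (src_column true w), columns_cons, ← hes]
      rfl
    | false =>
      rw [length_tgt_columns, columns_cons, Path2.src_comp0, src_column] at h'
      cases cs with
      | nil =>
        rw [List.length_append, length_columnSource_false, List.length_nil] at h'
        omega
      | cons c cs =>
        have e : (columns (Q := Q) cs).tgt = (columns ds).src := by
          apply onePath_ext
          rw [List.length_append, length_columnSource_false, List.length_cons] at h'
          rw [length_tgt_columns]
          omega
        obtain ⟨es, hes⟩ := ih cs e
        refine ⟨(c.1, w ++ c.2) :: es, Path2.cls_injective ?_⟩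
        refine (Cls.exchange (column c.1 c.2).1.cls (columns cs).cls (column false w).1.cls
          (columns ds).cls ((tgt_column c.1 c.2).trans (src_column false w).symm) e).trans ?_
        rw [cls_column_append, columns_cons, ← hes]
        rfl

theorem column_singleton (b : Bool) (w : List (Option A)) :
    columns (Q := Q) [(b, w)] = (column b w).1 := by
  apply Path2.cls_injective
  simp [Cls.c0_one]

theorem exists_columns_id (u : List (sig A Q).poly2.OneCell) : ∃ cs, Path2.id u = columns cs := by
  induction u with
  | nil => exact ⟨[], rfl⟩
  | cons ξ u ih =>
    obtain ⟨cs, hcs⟩ := ih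
    refine ⟨(false, []) :: cs, ?_⟩
    rw [columns_cons, ← hcs]
    exact Path2.cls_injective (Cls.one_c0_one [ξ] u).symm

/-- Composites of constructors are juxtapositions of columns. -/
theorem exists_columns (f : (sig A Q).poly2.Path2) (hf : f.GeneratedBy (sig A Q).conCells) :
    ∃ cs, f = columns cs := by
  unfold Path2.GeneratedBy at hf
  induction f using Path2.induction with
  | id u => exact exists_columns_id u
  | cell φ =>
    rw [Path2.size_cell] at hf
    have h : φ ∈ (sig A Q).conCells := by simpa using hf
    obtain ⟨_ | a, rfl⟩ := h
    · exact ⟨[(true, [])], (column_singleton true []).symm⟩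
    · refine ⟨[(false, [a])], ?_⟩
      rw [column_singleton]
      exact Path2.cls_injective (Cls.one_c1 (letter (Q := Q) a).1.cls (letter a).2.1).symm
  | comp0 f g ihf ihg =>
    rw [Path2.size_comp0] at hf
    obtain ⟨cs, rfl⟩ := ihf (by omega)
    obtain ⟨ds, rfl⟩ := ihg (by omega)
    exact ⟨cs ++ ds, (columns_append cs ds).symm⟩
  | comp1 f g h ihf ihg =>
    rw [Path2.size_comp1] at hf
    obtain ⟨cs, rfl⟩ := ihf (by omega)
    obtain ⟨ds, rfl⟩ := ihg (by omega)
    exact exists_columns_comp1 cs ds h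

/-- Juxtaposition of words. -/
def words (ws : List (List (Option A))) : (sig A Q).poly2.Path2 :=
  columns (ws.map fun w => (true, w))

theorem words_append (vs ws : List (List (Option A))) :
    words (Q := Q) (vs ++ ws) = (words vs).comp0 (words ws) := by
  rw [words, List.map_append, columns_append]
  rfl

theorem words_singleton (w : List (Option A)) : words (Q := Q) [w] = (wordPath w).1 := by
  refine (column_singleton true w).trans (congrArg _ ?_)
  induction w with
  | nil => rfl
  | cons a w ih => exact congrArg (fun x => Hom.comp1 x (letter a)) ih

@[simp] theorem src_words (ws : List (List (Option A))) : (words (Q := Q) ws).src = [] := by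
  rw [words, src_columns]
  simp [columnSource]

@[simp] theorem length_tgt_words (ws : List (List (Option A))) :
    (words (Q := Q) ws).tgt.length = ws.length := by
  rw [words, length_tgt_columns, List.length_map]

/-- An open column would contribute a wire to the source. -/
theorem exists_words (f : (sig A Q).poly2.Path2) (hf : f.GeneratedBy (sig A Q).conCells)
    (h : f.src = []) : ∃ ws, f = words ws := by
  obtain ⟨cs, rfl⟩ := exists_columns f hf
  refine ⟨cs.map Prod.snd, ?_⟩
  rw [words, List.map_map]
  congr
  refine (List.map_id cs).symm.trans (List.map_congr_left fun c hc => ?_)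
  rw [src_columns, List.flatMap_eq_nil_iff] at h
  have := h c hc
  obtain ⟨_ | _, w⟩ := c
  · cases this
  · rfl

/-! ### Evaluation -/

theorem eval_comp1 (f g : (sig A Q).poly2.Path2) (h : f.tgt = g.src) (xs : List (Tree A Q))
    (hx : xs.length = f.src.length) :
    (treeModel A Q).eval (f.comp1 g h) xs = (treeModel A Q).eval g ((treeModel A Q).eval f xs) :=
  (treeModel A Q).eval_comp1 f g h xs hx

theorem eval_nil : (treeModel A Q).eval (nil (A := A) (Q := Q)).1 [] = [.nil] :=
  (treeModel A Q).eval_cell _ _ rfl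

theorem eval_wire (t : Tree A Q) : (treeModel A Q).eval wire.1 [t] = [t] :=
  (treeModel A Q).eval_id _ _ rfl

theorem eval_letter (a : Option A) (t : Tree A Q) :
    (treeModel A Q).eval (letter a).1 [t] = [.letter a t] :=
  (treeModel A Q).eval_cell _ _ rfl

theorem eval_main (t : Tree A Q) : (treeModel A Q).eval main.1 [t] = [.main t] :=
  (treeModel A Q).eval_cell _ _ rfl

theorem eval_step (q : Q) (a : Option A) (s t : Tree A Q) :
    (treeModel A Q).eval (step q a).1 [s, t] = [.step q a s t] :=
  (treeModel A Q).eval_cell _ _ rfl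

theorem eval_eraser (t : Tree A Q) : (treeModel A Q).eval eraser.1 [t] = [] :=
  (treeModel A Q).eval_cell _ _ rfl

theorem eval_openColumn (w : List (Option A)) (t : Tree A Q) :
    (treeModel A Q).eval (column false w).1 [t] = [addLetters w t] := by
  induction w with
  | nil => exact eval_wire t
  | cons a w ih =>
    refine (eval_comp1 (column false w).1 (letter a).1 (tgt_column false w) [t] ?_).trans ?_
    · rw [src_column]
      rfl
    · rw [ih, eval_letter]
      rfl

theorem eval_closedColumn (w : List (Option A)) :
    (treeModel A Q).eval (column true w).1 [] = [wordTree w] := by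
  induction w with
  | nil => exact eval_nil
  | cons a w ih =>
    refine (eval_comp1 (column true w).1 (letter a).1 (tgt_column true w) [] ?_).trans ?_
    · rw [src_column]
      rfl
    · rw [ih, eval_letter]
      rfl

theorem eval_words (ws : List (List (Option A))) :
    (treeModel A Q).eval (words ws) [] = ws.map wordTree := by
  induction ws with
  | nil => exact (treeModel A Q).eval_id _ _ rfl
  | cons w ws ih =>
    refine ((treeModel A Q).eval_comp0 (column true w).1 (words ws) [] [] ?_ ?_).trans ?_
    · rw [src_column]
      rfl
    · rw [src_words]
      rfl
    · rw [ih, eval_closedColumn]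
      rfl

/-- Values are determined by their interpretation. -/
theorem eq_words_of_eval (f : (sig A Q).poly2.Path2) (hf : f.GeneratedBy (sig A Q).conCells)
    (h : f.src = []) (ws : List (List (Option A)))
    (e : (treeModel A Q).eval f [] = ws.map wordTree) : f = words ws := by
  obtain ⟨vs, rfl⟩ := exists_words f hf h
  rw [eval_words] at e
  rw [List.map_injective_iff.mpr wordTree_injective e]

theorem words_generated (ws : List (List (Option A))) :
    (words (Q := Q) ws).GeneratedBy (sig A Q).conCells := by
  induction ws with
  | nil => rfl
  | cons w ws ih =>
    have e : words (Q := Q) (w :: ws) = (wordPath w).1.comp0 (words ws) := by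
      rw [← words_singleton, ← words_append]
      rfl
    rw [e]
    unfold Path2.GeneratedBy
    rw [Path2.size_comp0]
    exact Nat.add_eq_zero_iff.mpr ⟨wordPath_generated w, ih⟩

end TuringMachine

namespace Polygraph2

variable {P : Polygraph2.{u}}

theorem Hom.size_comp0 {u v u' v' : List P.OneCell} (X : Set P.TwoCell) (f : P.Hom u v)
    (g : P.Hom u' v') : (f.comp0 g).1.size X = f.1.size X + g.1.size X :=
  Path2.size_comp0 X f.1 g.1

theorem Hom.size_comp1 {u v w : List P.OneCell} (X : Set P.TwoCell) (f : P.Hom u v)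
    (g : P.Hom v w) : (f.comp1 g).1.size X = f.1.size X + g.1.size X :=
  Path2.size_comp1 X f.1 g.1 (f.2.2.trans g.2.1.symm)

/-- With no wires beside `a` the two units for juxtaposition vanish, leaving a vertical composite.
-/
theorem IsPlug.eq_comp1 {k l a f : P.Path2} (h : IsPlug k [] [] l a f) :
    f = (k.comp1 a (by simp [← h.src_eq])).comp1 l (by simp [Path2.tgt_comp1, ← h.tgt_eq]) := by
  apply Path2.cls_injective
  rw [h.cls_eq, Cls.one_c0, Cls.c0_one, Path2.cls_comp1, Path2.cls_comp1, Cls.c1_assoc]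

theorem IsPlug.tgt_eq_src {k l a f : P.Path2} (h : IsPlug k [] [] l a f) : k.tgt = a.src := by
  simp [← h.src_eq]

theorem IsPlug.eq_comp1_of_id {k a f : P.Path2} {x : List P.OneCell}
    (h : IsPlug k [] [] (.id x) a f) : f = k.comp1 a h.tgt_eq_src :=
  h.eq_comp1.trans (Path2.comp1_id _ _ _)

theorem IsPlug.of_comp1 (k a : P.Path2) (h : k.tgt = a.src) :
    IsPlug k [] [] (.id a.tgt) a (k.comp1 a h) where
  src_eq := by simp [h]
  tgt_eq := by simp
  cls_eq := by
    rw [Cls.one_c0, Cls.c0_one, Path2.cls_comp1, Path2.cls_id, Cls.c1_one a.cls (u := a.tgt) rfl]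

theorem exists_isPlug (k : P.Path2) (u v : List P.OneCell) (l a : P.Path2)
    (h : u ++ (a.src ++ v) = k.tgt) (h' : u ++ (a.tgt ++ v) = l.src) :
    ∃ f, IsPlug k u v l a f :=
  ⟨k.comp1 (((Path2.id u).comp0 (a.comp0 (.id v))).comp1 l (by simp [Path2.tgt_comp0, h']))
    (by simp [Path2.src_comp1, Path2.src_comp0, h]), h, h', rfl⟩

end Polygraph2

/-! ### Counting functions, erasers and other non-constructors -/

namespace Signature

open Polygraph2

variable {S : Signature.{u}}

/-- The set of function 2-cells. -/
def funCells (S : Signature.{u}) : Set S.poly2.TwoCell := Set.range Cell.func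

/-- The set of erasers. -/
def eraseCells (S : Signature.{u}) : Set S.poly2.TwoCell := Set.range Cell.erase

theorem funCells_subset : S.funCells ⊆ S.conCellsᶜ := by
  rintro _ ⟨φ, rfl⟩ ⟨_, h⟩
  cases h

theorem eraseCells_subset : S.eraseCells ⊆ S.conCellsᶜ := by
  rintro _ ⟨φ, rfl⟩ ⟨_, h⟩
  cases h

theorem size_conCell (φ : S.Con) : (conCell φ).1.size S.conCellsᶜ = 0 ∧
    (conCell φ).1.size S.funCells = 0 ∧ (conCell φ).1.size S.eraseCells = 0 := by
  have h : (conCell φ).1.size S.conCellsᶜ = 0 := if_neg (not_not.mpr ⟨φ, rfl⟩)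
  have h₁ := Path2.size_mono funCells_subset (conCell φ).1
  have h₂ := Path2.size_mono eraseCells_subset (conCell φ).1
  omega

theorem size_funCell (φ : S.Fun) : (funCell φ).1.size S.conCellsᶜ = 1 ∧
    (funCell φ).1.size S.funCells = 1 :=
  ⟨if_pos (funCells_subset ⟨φ, rfl⟩), if_pos ⟨φ, rfl⟩⟩

theorem size_eraseCell (ξ : S.OneCell) : (eraseCell ξ).1.size S.conCellsᶜ = 1 ∧
    (eraseCell ξ).1.size S.funCells = 0 ∧ (eraseCell ξ).1.size S.eraseCells = 1 :=
  ⟨if_pos (eraseCells_subset ⟨ξ, rfl⟩), if_neg (by rintro ⟨_, h⟩; cases h), if_pos ⟨ξ, rfl⟩⟩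

theorem size_swapCell (ξ ζ : S.OneCell) : (swapCell ξ ζ).1.size S.conCellsᶜ = 1 ∧
    (swapCell ξ ζ).1.size S.funCells = 0 ∧ (swapCell ξ ζ).1.size S.eraseCells = 0 :=
  ⟨if_pos (by rintro ⟨_, h⟩; cases h), if_neg (by rintro ⟨_, h⟩; cases h),
    if_neg (by rintro ⟨_, h⟩; cases h)⟩

theorem size_dupCell (ξ : S.OneCell) : (dupCell ξ).1.size S.conCellsᶜ = 1 ∧
    (dupCell ξ).1.size S.funCells = 0 ∧ (dupCell ξ).1.size S.eraseCells = 0 :=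
  ⟨if_pos (by rintro ⟨_, h⟩; cases h), if_neg (by rintro ⟨_, h⟩; cases h),
    if_neg (by rintro ⟨_, h⟩; cases h)⟩

/-- The structure 2-cell in the source of a structure 3-cell is its only 2-cell that is not a
constructor. -/
theorem StructCell.size_source (α : S.StructCell) :
    α.source.1.size S.conCellsᶜ = 1 ∧ α.source.1.size S.funCells = 0 ∧
      (α.source.1.size S.eraseCells = 0 ∨ ∃ φ, α = .erase φ) := by
  rcases α with ⟨φ, ζ⟩ | ⟨ζ, φ⟩ | φ | φ
  · have e : ∀ X, (swapLeft φ ζ).source.1.size X = (conCell φ).1.size X + 0 +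
      (swapCell (S.conTarget φ) ζ).1.size X := fun _ => rfl
    have h₁ := size_conCell φ
    have h₂ := size_swapCell (S.conTarget φ) ζ
    simp only [e]
    omega
  · have e : ∀ X, (swapRight ζ φ).source.1.size X = 0 + (conCell φ).1.size X +
      (swapCell ζ (S.conTarget φ)).1.size X := fun _ => rfl
    have h₁ := size_conCell φ
    have h₂ := size_swapCell ζ (S.conTarget φ)
    simp only [e]
    omega
  · have e : ∀ X, (dup φ).source.1.size X = (conCell φ).1.size X +
      (dupCell (S.conTarget φ)).1.size X := fun _ => rfl
    have h₁ := size_conCell φ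
    have h₂ := size_dupCell (S.conTarget φ)
    simp only [e]
    omega
  · have e : ∀ X, (erase φ).source.1.size X = (conCell φ).1.size X +
      (eraseCell (S.conTarget φ)).1.size X := fun _ => rfl
    have h₁ := size_conCell φ
    have h₂ := size_eraseCell (S.conTarget φ)
    simp only [e]
    exact ⟨by omega, by omega, .inr ⟨φ, rfl⟩⟩

end Signature

/-! ### Reductions at the root of a closed 2-path -/

namespace TuringMachine

open Polygraph2 Polygraph3

variable {A Q : Type u} {M : TuringMachine A Q}

theorem size_feed {u v : List (sig A Q).OneCell} (f : (sig A Q).poly2.Hom u (W A Q))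
    (g : (sig A Q).poly2.Hom v (W A Q)) (q : Q) (a : Option A)
    (hf : f.1.GeneratedBy (sig A Q).conCells) (hg : g.1.GeneratedBy (sig A Q).conCells) :
    (feed f g q a).1.size (sig A Q).conCellsᶜ = 1 ∧
      (feed f g q a).1.size (sig A Q).funCells = 1 := by
  have hf' : f.1.size (sig A Q).conCellsᶜ = 0 := hf
  have hg' : g.1.size (sig A Q).conCellsᶜ = 0 := hg
  have hf'' := Path2.size_mono Signature.funCells_subset f.1
  have hg'' := Path2.size_mono Signature.funCells_subset g.1
  have e : ∀ X, (feed f g q a).1.size X = f.1.size X + g.1.size X + (step q a).1.size X := by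
    intro X
    refine (Hom.size_comp1 (P := (sig A Q).poly2) X (f.comp0 g) (step q a)).trans ?_
    exact congrArg (· + _) (Hom.size_comp0 (P := (sig A Q).poly2) X f g)
  have h₁ : (step q a).1.size (sig A Q).conCellsᶜ = 1 := (Signature.size_funCell _).1
  have h₂ : (step q a).1.size (sig A Q).funCells = 1 := (Signature.size_funCell _).2
  rw [e, e, h₁, h₂]
  omega

/-- The counterpart of `StructCell.size_source`: the only non-constructor is now a function. These
two counts decide which 3-cells can apply to a given 2-path. -/
theorem size_compSource (c : M.Comp) :
    (compSource c).1.size (sig A Q).conCellsᶜ = 1 ∧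
      (compSource c).1.size (sig A Q).funCells = 1 := by
  rcases c with _ | ⟨_ | _ | _ | _⟩ | _
  · exact Signature.size_funCell _
  · exact size_feed _ _ _ _ nil_generated wire_generated
  · exact size_feed _ _ _ _ (letter_generated _) wire_generated
  · exact size_feed _ _ _ _ wire_generated nil_generated
  · exact size_feed _ _ _ _ wire_generated (letter_generated _)
  · exact Signature.size_funCell _

/-- If a composite of constructors is applied to a 2-path with one output and the result is not
the tree of a letter, then this composite is an identity. -/
theorem isPlug_trivial {k l a f : (sig A Q).poly2.Path2} {u v : List (sig A Q).poly2.OneCell}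
    (h : IsPlug k u v l a f) (hk : k.GeneratedBy (sig A Q).conCells)
    (hl : l.GeneratedBy (sig A Q).conCells) (ha : a.tgt.length = 1) (hs : f.src = [])
    (ht : f.tgt.length = 1) (T : Tree A Q) (hT : ∀ b s, T ≠ .letter b s)
    (he : (treeModel A Q).eval f [] = [T]) :
    u = [] ∧ v = [] ∧ l = .id (columnSource A Q false) ∧ ∃ ws, k = words ws := by
  have hks : k.src = [] := by rw [← h.src_path, hs]
  have hlu := congrArg List.length h.tgt_eq
  obtain ⟨ws, rfl⟩ := exists_words k hk hks
  obtain ⟨cs, rfl⟩ := exists_columns l hl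
  have hcs : cs.length = 1 := by rw [← length_tgt_columns (Q := Q), ← h.tgt_path, ht]
  obtain ⟨⟨b, w⟩, rfl⟩ := List.length_eq_one_iff.mp hcs
  rw [column_singleton] at h hlu ⊢
  rw [List.length_append, List.length_append, src_column] at hlu
  -- The single column of `l` receives the output of `a`: it is open, and no wire is left for `u`
  -- and `v`.
  cases b with
  | true =>
    rw [columnSource_true, List.length_nil] at hlu
    omega
  | false =>
    rw [length_columnSource_false] at hlu
    obtain rfl := List.eq_nil_of_length_eq_zero (l := u) (by omega)
    obtain rfl := List.eq_nil_of_length_eq_zero (l := v) (by omega)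
    refine ⟨rfl, rfl, ?_, ws, rfl⟩
    rw [h.eq_comp1, eval_comp1 _ _ _ _ (by rw [Path2.src_comp1, hks]; rfl)] at he
    obtain ⟨t, ht'⟩ := List.length_eq_one_iff.mp
      (((treeModel A Q).length_eval ((words ws).comp1 a (by simp [← h.src_eq])) []
      (by rw [Path2.src_comp1, hks]; rfl)).trans (by rw [Path2.tgt_comp1, ha]))
    rw [ht', eval_openColumn] at he
    -- A letter remaining in `l` would be the root of the tree `T`.
    cases w with
    | nil => rfl
    | cons b w =>
      simp only [addLetters_cons, List.cons.injEq, and_true] at he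
      exact absurd he.symm (hT _ _)

section

variable [Finite A] [Finite Q]

theorem reducesBy_inl_iff {α : (sig A Q).StructCell} {f g : (sig A Q).poly2.Path2} :
    ReducesBy (P := M.program.poly3) (Sum.inl α) f g ↔
      ∃ (k : (sig A Q).poly2.Path2) (u v : List (sig A Q).poly2.OneCell)
        (l : (sig A Q).poly2.Path2),
        IsPlug k u v l α.source.1 f ∧ IsPlug k u v l α.target.1 g :=
  reducesBy_iff (P := M.program.poly3)

theorem reducesBy_inr_iff {c : M.Comp} {f g : (sig A Q).poly2.Path2} :
    ReducesBy (P := M.program.poly3) (Sum.inr c) f g ↔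
      ∃ (k : (sig A Q).poly2.Path2) (u v : List (sig A Q).poly2.OneCell)
        (l : (sig A Q).poly2.Path2),
        IsPlug k u v l (compSource c).1 f ∧ IsPlug k u v l (compTarget c).1 g :=
  reducesBy_iff (P := M.program.poly3)

/-- The reductions of a closed 2-path with one function 2-cell, at its root. -/
theorem exists_comp_of_reducesBy {f g : (sig A Q).poly2.Path2} {α : M.program.poly3.ThreeCell}
    (h : ReducesBy (P := M.program.poly3) α f g) (hs : f.src = []) (ht : f.tgt.length = 1)
    (hc : f.size (sig A Q).conCellsᶜ = 1) (hf : f.size (sig A Q).funCells = 1)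
    (T : Tree A Q) (hT : ∀ b s, T ≠ .letter b s) (he : (treeModel A Q).eval f [] = [T]) :
    ∃ (c : M.Comp) (ws : List (List (Option A))) (e : (words ws).tgt = (compSource c).1.src)
      (e' : (words ws).tgt = (compTarget c).1.src), α = Sum.inr c ∧
      f = (words ws).comp1 (compSource c).1 e ∧ g = (words ws).comp1 (compTarget c).1 e' := by
  rcases α with α | c
  -- The source of a structure 3-cell uses up the only non-constructor of `f` without containing a
  -- function, whereas `f` contains one.
  · obtain ⟨k, u, v, l, H, -⟩ := reducesBy_inl_iff.mp h
    have h₁ := H.size_path (sig A Q).conCellsᶜ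
    have h₂ := H.size_path (sig A Q).funCells
    have h₃ := Path2.size_mono Signature.funCells_subset k
    have h₄ := Path2.size_mono Signature.funCells_subset l
    have h₅ := Signature.StructCell.size_source (S := sig A Q) α
    omega
  · obtain ⟨k, u, v, l, H, H'⟩ := reducesBy_inr_iff.mp h
    have h₁ := H.size_path (sig A Q).conCellsᶜ
    have h₂ := (size_compSource c).1
    have hk : k.GeneratedBy (sig A Q).conCells := by
      unfold Path2.GeneratedBy
      omega
    have hl : l.GeneratedBy (sig A Q).conCells := by
      unfold Path2.GeneratedBy
      omega
    obtain ⟨rfl, rfl, rfl, ws, rfl⟩ := isPlug_trivial H hk hl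
      (congrArg List.length (compSource c).2.2) hs ht T hT he
    exact ⟨c, ws, _, _, rfl, H.eq_comp1_of_id, H'.eq_comp1_of_id⟩

theorem reducesBy_words (c : M.Comp) (ws : List (List (Option A)))
    (e : (words ws).tgt = (compSource c).1.src) (e' : (words ws).tgt = (compTarget c).1.src) :
    ReducesBy (P := M.program.poly3) (Sum.inr c) ((words ws).comp1 (compSource c).1 e)
      ((words ws).comp1 (compTarget c).1 e') := by
  refine reducesBy_inr_iff.mpr ⟨words ws, [], [], .id (W A Q), ?_, ?_⟩
  · have := IsPlug.of_comp1 _ _ e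
    rwa [(compSource c).2.2] at this
  · have := IsPlug.of_comp1 _ _ e'
    rwa [(compTarget c).2.2] at this

end

/-! ### Configurations -/

theorem feed_words (v w : List (Option A)) (q : Q) (a : Option A)
    (h : (words (Q := Q) [v, w]).tgt = (step q a).1.src) :
    (words [v, w]).comp1 (step q a).1 h = (feed (wordPath v) (wordPath w) q a).1 := by
  have e : words (Q := Q) [v, w] = (wordPath v).1.comp0 (wordPath w).1 := by
    rw [← words_singleton, ← words_singleton, ← words_append]
    rfl
  apply Path2.cls_injective
  rw [Path2.cls_comp1, e]
  rfl

/-- Words followed by `f ⋆₀ g` form a closed composite of constructors, which its trees determine.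
It is therefore enough to evaluate `f` and `g`, with no exchange computation; all transitions are
verified in this way. -/
theorem words_comp1_feed {x y : List (sig A Q).OneCell} (f : (sig A Q).poly2.Hom x (W A Q))
    (g : (sig A Q).poly2.Hom y (W A Q)) (q : Q) (a : Option A)
    (hf : f.1.GeneratedBy (sig A Q).conCells) (hg : g.1.GeneratedBy (sig A Q).conCells)
    (us ws : List (List (Option A))) (h : (words (us ++ ws)).tgt = (feed f g q a).1.src)
    (hu : us.length = x.length) (hw : ws.length = y.length) (v w : List (Option A))
    (ev : (treeModel A Q).eval f.1 (us.map wordTree) = [wordTree v])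
    (ew : (treeModel A Q).eval g.1 (ws.map wordTree) = [wordTree w]) :
    (words (us ++ ws)).comp1 (feed f g q a).1 h = (feed (wordPath v) (wordPath w) q a).1 := by
  have hfg : (words (Q := Q) (us ++ ws)).tgt = (f.1.comp0 g.1).src := by
    apply onePath_ext
    rw [length_tgt_words, Path2.src_comp0, List.length_append, List.length_append, hu, hw,
      f.2.1, g.2.1]
    rfl
  have key : (words (us ++ ws)).comp1 (f.1.comp0 g.1) hfg = words [v, w] := by
    apply eq_words_of_eval
    · unfold Path2.GeneratedBy
      rw [Path2.size_comp1, Path2.size_comp0]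
      have h₁ := words_generated (Q := Q) (us ++ ws)
      unfold Path2.GeneratedBy at h₁ hf hg
      omega
    · rw [Path2.src_comp1, src_words]
    · rw [eval_comp1 _ _ _ _ (by rw [src_words]; rfl), eval_words, List.map_append,
        (treeModel A Q).eval_comp0, ev, ew]
      · rfl
      · rw [List.length_map, hu, f.2.1]
        rfl
      · rw [List.length_map, hw, g.2.1]
        rfl
  have hs : (words (Q := Q) [v, w]).tgt = (step q a).1.src :=
    onePath_ext (length_tgt_words _)
  rw [← feed_words v w q a hs]
  apply Path2.cls_injective
  rw [Path2.cls_comp1, Path2.cls_comp1, ← key, Path2.cls_comp1, Cls.c1_assoc]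
  rfl

theorem eval_feed_wordPath (v w : List (Option A)) (q : Q) (a : Option A) :
    (treeModel A Q).eval (feed (wordPath v) (wordPath w) q a).1 [] =
      [.step q a (wordTree v) (wordTree w)] := by
  rw [← feed_words v w q a (onePath_ext (length_tgt_words _)),
    eval_comp1 _ _ _ _ (by rw [src_words]; rfl), eval_words]
  exact eval_step _ _ _ _

/-- The words to which the 3-cell of a rule is applied in a configuration. -/
def ruleArgs : M.Rule → M.Config → List (List (Option A))
  | .leftNil .., x => [x.right]
  | .leftCons .., x => [x.left.tail, x.right]
  | .rightNil .., x => [x.left]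
  | .rightCons .., x => [x.left, x.right.tail]

theorem stepBy_source {r : M.Rule} {x y : M.Config} (h : M.StepBy r x y)
    (e : (words (ruleArgs r x)).tgt = (compSource (M := M) (.trans r)).1.src) :
    (words (ruleArgs r x)).comp1 (compSource (M := M) (.trans r)).1 e =
      (feed (wordPath x.left) (wordPath x.right) x.state x.read).1 := by
  cases h with
  | leftNil q₁ a q₂ c h wr =>
    exact words_comp1_feed nil wire _ _ nil_generated wire_generated [] [wr] e rfl rfl _ _
      eval_nil (eval_wire _)
  | leftCons q₁ a q₂ c h b wl wr =>
    exact words_comp1_feed (letter b) wire _ _ (letter_generated b) wire_generated [wl] [wr] e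
      rfl rfl _ _ (eval_letter _ _) (eval_wire _)
  | rightNil q₁ a q₂ c h wl =>
    exact words_comp1_feed wire nil _ _ wire_generated nil_generated [wl] [] e rfl rfl _ _
      (eval_wire _) eval_nil
  | rightCons q₁ a q₂ c h b wl wr =>
    exact words_comp1_feed wire (letter b) _ _ wire_generated (letter_generated b) [wl] [wr] e
      rfl rfl _ _ (eval_wire _) (eval_letter _ _)

theorem stepBy_target {r : M.Rule} {x y : M.Config} (h : M.StepBy r x y)
    (e : (words (ruleArgs r x)).tgt = (compTarget (M := M) (.trans r)).1.src) :
    (words (ruleArgs r x)).comp1 (compTarget (M := M) (.trans r)).1 e =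
      (feed (wordPath y.left) (wordPath y.right) y.state y.read).1 := by
  cases h with
  | leftNil q₁ a q₂ c h wr =>
    exact words_comp1_feed nil (letter c) _ _ nil_generated (letter_generated c) [] [wr] e
      rfl rfl _ _ eval_nil (eval_letter _ _)
  | leftCons q₁ a q₂ c h b wl wr =>
    exact words_comp1_feed wire (letter c) _ _ wire_generated (letter_generated c) [wl] [wr] e
      rfl rfl _ _ (eval_wire _) (eval_letter _ _)
  | rightNil q₁ a q₂ c h wl =>
    exact words_comp1_feed (letter c) nil _ _ (letter_generated c) nil_generated [wl] [] e
      rfl rfl _ _ (eval_letter _ _) eval_nil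
  | rightCons q₁ a q₂ c h b wl wr =>
    exact words_comp1_feed (letter c) wire _ _ (letter_generated c) wire_generated [wl] [wr] e
      rfl rfl _ _ (eval_letter _ _) (eval_wire _)

/-- The 3-cell of a rule has no other instances at the root than those given by transitions: any
words on its inputs are the arguments at some configuration. -/
theorem exists_stepBy (r : M.Rule) (ws : List (List (Option A)))
    (h : ws.length = (compDom (M := M) (.trans r)).length) :
    ∃ x y, M.StepBy r x y ∧ ruleArgs r x = ws := by
  cases r with
  | leftNil q₁ a q₂ c e =>
    obtain ⟨w, rfl⟩ := List.length_eq_one_iff.mp h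
    exact ⟨_, _, .leftNil q₁ a q₂ c e w, rfl⟩
  | leftCons q₁ a q₂ c e b =>
    obtain ⟨v, w, rfl⟩ := List.length_eq_two.mp h
    exact ⟨_, _, .leftCons q₁ a q₂ c e b v w, rfl⟩
  | rightNil q₁ a q₂ c e =>
    obtain ⟨w, rfl⟩ := List.length_eq_one_iff.mp h
    exact ⟨_, _, .rightNil q₁ a q₂ c e w, rfl⟩
  | rightCons q₁ a q₂ c e b =>
    obtain ⟨v, w, rfl⟩ := List.length_eq_two.mp h
    exact ⟨_, _, .rightCons q₁ a q₂ c e b v w, rfl⟩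

theorem length_ruleArgs {r : M.Rule} {x y : M.Config} (_ : M.StepBy r x y) :
    (ruleArgs r x).length = (compDom (M := M) (.trans r)).length := by
  cases r <;> rfl

/-- State and symbol determine `q₂`, `c` and the direction through `δ`; the word on the side of the
move, empty or with first letter `b`, then determines the case. -/
theorem stepBy_deterministic {r r' : M.Rule} {x y y' : M.Config} (h : M.StepBy r x y)
    (h' : M.StepBy r' x y') : r = r' ∧ y = y' := by
  cases h with
  | leftNil q₁ a q₂ c e wr =>
    generalize hx : (⟨q₁, a, [], wr⟩ : M.Config) = x at h'
    cases h' <;> simp only [Config.mk.injEq, Subtype.val_inj] at hx <;> grind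
  | leftCons q₁ a q₂ c e b wl wr =>
    generalize hx : (⟨q₁, a, b :: wl, wr⟩ : M.Config) = x at h'
    cases h' <;> simp only [Config.mk.injEq, Subtype.val_inj] at hx <;> grind
  | rightNil q₁ a q₂ c e wl =>
    generalize hx : (⟨q₁, a, wl, []⟩ : M.Config) = x at h'
    cases h' <;> simp only [Config.mk.injEq, Subtype.val_inj] at hx <;> grind
  | rightCons q₁ a q₂ c e b wl wr =>
    generalize hx : (⟨q₁, a, wl, b :: wr⟩ : M.Config) = x at h'
    cases h' <;> simp only [Config.mk.injEq, Subtype.val_inj] at hx <;> grind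

theorem stepBy_state_ne {r : M.Rule} {x y : M.Config} (h : M.StepBy r x y) : x.state ≠ M.qf := by
  cases h with
  | leftNil q₁ => exact q₁.2
  | leftCons q₁ => exact q₁.2
  | rightNil q₁ => exact q₁.2
  | rightCons q₁ => exact q₁.2

end TuringMachine

/-! ### The semantics as a unique normal form -/

namespace PolygraphicProgram

variable {P : PolygraphicProgram.{u}}

theorem mem_sem_iff {u v : List P.OneCell} (f : P.poly2.Hom u v) (t : P.Value u)
    (t' : P.Value v) : t' ∈ sem f t ↔
      ∀ y : P.poly3.Path2, Polygraph3.IsNormalFormOf y (applyTo f t) ↔ y = t'.1.1 := by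
  constructor
  · rintro ⟨h, rfl⟩
    exact h.choose_spec
  · intro h
    -- The chosen value and `t'` both describe the unique normal form, so they agree.
    refine ⟨⟨t', h⟩, Subtype.ext (Subtype.ext ?_)⟩
    have hs := (⟨t', h⟩ : ∃ t' : P.Value v, ∀ y : P.poly3.Path2,
      Polygraph3.IsNormalFormOf y (applyTo f t) ↔ y = t'.1.1).choose_spec
    exact (h _).mp ((hs _).mpr rfl)

end PolygraphicProgram

/-! ### Reductions of configurations and of the main function -/

namespace TuringMachine

open Polygraph2 Polygraph3

variable {A Q : Type u} {M : TuringMachine A Q}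

/-- The 2-path of a configuration. -/
def configPath (x : M.Config) : (sig A Q).poly2.Path2 :=
  (feed (wordPath x.left) (wordPath x.right) x.state x.read).1

theorem configPath_injective : Function.Injective (configPath (M := M)) := by
  rintro ⟨q, a, v, w⟩ ⟨q', a', v', w'⟩ h
  have e := congrArg (fun f => (treeModel A Q).eval f []) h
  simp only [configPath, eval_feed_wordPath, List.cons.injEq, Tree.step.injEq, and_true] at e
  obtain ⟨rfl, rfl, hv, hw⟩ := e
  rw [wordTree_injective hv, wordTree_injective hw]

theorem src_configPath (x : M.Config) : (configPath x).src = [] := (feed _ _ _ _).2.1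

theorem length_tgt_configPath (x : M.Config) : (configPath x).tgt.length = 1 :=
  congrArg List.length (feed (wordPath x.left) (wordPath x.right) x.state x.read).2.2

theorem eval_configPath (x : M.Config) : (treeModel A Q).eval (configPath x) [] =
    [.step x.state x.read (wordTree x.left) (wordTree x.right)] :=
  eval_feed_wordPath _ _ _ _

theorem size_configPath (x : M.Config) : (configPath x).size (sig A Q).conCellsᶜ = 1 ∧
    (configPath x).size (sig A Q).funCells = 1 :=
  size_feed _ _ _ _ (wordPath_generated _) (wordPath_generated _)

/-- The 2-path of the main function applied to a word. -/
def mainPath (w : List (Option A)) : (sig A Q).poly2.Path2 := ((wordPath w).comp1 main).1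

theorem words_comp1_main (w : List (Option A))
    (e : (words (Q := Q) [w]).tgt = (main (A := A)).1.src) :
    (words [w]).comp1 main.1 e = mainPath w := by
  apply Path2.cls_injective
  rw [Path2.cls_comp1, words_singleton]
  rfl

theorem eval_mainPath (w : List (Option A)) :
    (treeModel A Q).eval (mainPath w) [] = [.main (wordTree w)] := by
  rw [← words_comp1_main w (onePath_ext (length_tgt_words _)),
    eval_comp1 _ _ _ _ (by rw [src_words]; rfl), eval_words]
  exact eval_main _

theorem size_mainPath (w : List (Option A)) :
    (mainPath (Q := Q) w).size (sig A Q).conCellsᶜ = 1 ∧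
    (mainPath (Q := Q) w).size (sig A Q).funCells = 1 := by
  have e : ∀ X, (mainPath (Q := Q) w).size X = (wordPath w).1.size X + main.1.size X :=
    fun X => Hom.size_comp1 (P := (sig A Q).poly2) X (wordPath w) main
  have h₀ : (wordPath (Q := Q) w).1.size (sig A Q).conCellsᶜ = 0 := wordPath_generated w
  have h₁ := Path2.size_mono Signature.funCells_subset (wordPath (Q := Q) w).1
  have h₂ : (main (A := A) (Q := Q)).1.size (sig A Q).conCellsᶜ = 1 :=
    (Signature.size_funCell _).1
  have h₃ : (main (A := A) (Q := Q)).1.size (sig A Q).funCells = 1 :=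
    (Signature.size_funCell _).2
  rw [e, e]
  omega

theorem tgt_words_eq_compSource (c : M.Comp) (ws : List (List (Option A)))
    (h : ws.length = (compDom c).length) : (words ws).tgt = (compSource c).1.src :=
  onePath_ext ((length_tgt_words ws).trans (h.trans (congrArg _ (compSource c).2.1.symm)))

theorem tgt_words_eq_compTarget (c : M.Comp) (ws : List (List (Option A)))
    (h : ws.length = (compDom c).length) : (words ws).tgt = (compTarget c).1.src :=
  onePath_ext ((length_tgt_words ws).trans (h.trans (congrArg _ (compTarget c).2.1.symm)))

theorem length_of_tgt_words_eq (c : M.Comp) (ws : List (List (Option A)))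
    (h : (words ws).tgt = (compSource c).1.src) : ws.length = (compDom c).length := by
  rw [← length_tgt_words (Q := Q) ws, h, (compSource c).2.1]
  rfl

/-- The result of the final 3-cell on a configuration. -/
def finalPath (v w : List (Option A)) : (sig A Q).poly2.Path2 :=
  (words [v, w]).comp1 (eraser.1.comp0 wire.1) (onePath_ext (length_tgt_words _))

theorem words_comp1_init (w : List (Option A))
    (e : (words [w]).tgt = (compTarget (M := M) .init).1.src) :
    (words [w]).comp1 (compTarget (M := M) .init).1 e = configPath (M.start w) :=
  words_comp1_feed nil wire _ _ nil_generated wire_generated [] [w] e rfl rfl _ _ eval_nil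
    (eval_wire _)

section

variable [Finite A] [Finite Q]

theorem reducesBy_of_stepBy {r : M.Rule} {x y : M.Config} (h : M.StepBy r x y) :
    ReducesBy (P := M.program.poly3) (Sum.inr (.trans r)) (configPath x) (configPath y) := by
  have e := tgt_words_eq_compSource _ _ (length_ruleArgs h)
  have e' := tgt_words_eq_compTarget _ _ (length_ruleArgs h)
  have := reducesBy_words (.trans r) _ e e'
  rwa [stepBy_source h, stepBy_target h] at this

theorem reducesBy_finish (a : Option A) (v w : List (Option A)) :
    ReducesBy (P := M.program.poly3) (Sum.inr (.finish a))
      (configPath (M := M) ⟨M.qf, a, v, w⟩) (finalPath v w) := by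
  have e := tgt_words_eq_compSource (M := M) (.finish a) [v, w] rfl
  have e' := tgt_words_eq_compTarget (M := M) (.finish a) [v, w] rfl
  have := reducesBy_words (.finish a) _ e e'
  rwa [show (words [v, w]).comp1 (compSource (M := M) (.finish a)).1 e = _ from
    feed_words v w M.qf a e] at this

/-- The redex is at the root with words on its inputs. For a rule, these words and the 3-cell
describe a configuration with the same 2-path as `x`, which is `x` by injectivity. -/
theorem stepBy_of_reducesBy {α : M.program.poly3.ThreeCell} {x : M.Config}
    {g : (sig A Q).poly2.Path2} (h : ReducesBy (P := M.program.poly3) α (configPath x) g) :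
    (∃ r y, α = Sum.inr (.trans r) ∧ g = configPath y ∧ M.StepBy r x y) ∨
      (x.state = M.qf ∧ α = Sum.inr (.finish x.read) ∧ g = finalPath x.left x.right) := by
  obtain ⟨c, ws, e, e', rfl, hf, hg⟩ := exists_comp_of_reducesBy h (src_configPath x)
    (length_tgt_configPath x) (size_configPath x).1 (size_configPath x).2 _ (by simp)
    (eval_configPath x)
  have hl := length_of_tgt_words_eq c ws e
  rcases c with _ | r | a
  · obtain ⟨w, rfl⟩ := List.length_eq_one_iff.mp hl
    -- The roots `step` and `main` differ.
    have := congrArg (fun f => (treeModel A Q).eval f []) (hf.trans (words_comp1_main w e))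
    simp [eval_configPath, eval_mainPath] at this
  · left
    obtain ⟨x', y, hs, rfl⟩ := exists_stepBy r ws hl
    obtain rfl : x = x' := configPath_injective (hf.trans (stepBy_source hs e))
    exact ⟨r, y, rfl, hg.trans (stepBy_target hs e'), hs⟩
  · right
    obtain ⟨v, w, rfl⟩ := List.length_eq_two.mp hl
    obtain rfl : x = ⟨M.qf, a, v, w⟩ :=
      configPath_injective (hf.trans (feed_words v w M.qf a e))
    exact ⟨rfl, rfl, hg⟩

theorem reducesBy_init (w : List (Option A)) :
    ReducesBy (P := M.program.poly3) (Sum.inr .init) (mainPath w) (configPath (M.start w)) := by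
  have e := tgt_words_eq_compSource (M := M) .init [w] rfl
  have e' := tgt_words_eq_compTarget (M := M) .init [w] rfl
  have := reducesBy_words .init _ e e'
  rwa [words_comp1_init, show (words [w]).comp1 (compSource (M := M) .init).1 e = _ from
    words_comp1_main w e] at this

theorem eq_of_reducesBy_mainPath {α : M.program.poly3.ThreeCell} {w : List (Option A)}
    {g : (sig A Q).poly2.Path2} (h : ReducesBy (P := M.program.poly3) α (mainPath w) g) :
    g = configPath (M.start w) := by
  obtain ⟨c, ws, e, e', rfl, hf, hg⟩ := exists_comp_of_reducesBy h
    ((wordPath w).comp1 (P := (sig A Q).poly2) main).2.1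
    (congrArg List.length ((wordPath w).comp1 (P := (sig A Q).poly2) main).2.2)
    (size_mainPath w).1 (size_mainPath w).2 _ (by simp) (eval_mainPath w)
  have hl := length_of_tgt_words_eq c ws e
  rcases c with _ | r | a
  · obtain ⟨v, rfl⟩ := List.length_eq_one_iff.mp hl
    have := congrArg (fun f => (treeModel A Q).eval f []) (hf.trans (words_comp1_main v e))
    simp only [eval_mainPath, List.cons.injEq, Tree.main.injEq, and_true] at this
    obtain rfl := wordTree_injective this
    exact hg.trans (words_comp1_init _ e')
  · obtain ⟨x, y, hs, rfl⟩ := exists_stepBy r ws hl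
    have := congrArg (fun f => (treeModel A Q).eval f []) (hf.trans (stepBy_source hs e))
    simp [eval_feed_wordPath, eval_mainPath] at this
  · obtain ⟨u, v, rfl⟩ := List.length_eq_two.mp hl
    have := congrArg (fun f => (treeModel A Q).eval f []) (hf.trans (feed_words u v M.qf a e))
    simp [eval_feed_wordPath, eval_mainPath] at this

end

/-! ### Erasing the left word -/

/-- `f` is a closed 2-path made of constructors and at most one eraser, and its value is `w`. -/
structure Erasing (w : List (Option A)) (f : (sig A Q).poly2.Path2) : Prop where
  src_eq : f.src = []
  length_tgt : f.tgt.length = 1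
  size_le : f.size (sig A Q).conCellsᶜ ≤ 1
  size_eq : f.size (sig A Q).eraseCells = f.size (sig A Q).conCellsᶜ
  eval_eq : (treeModel A Q).eval f [] = [wordTree w]

theorem erasing_finalPath (v w : List (Option A)) :
    Erasing w (finalPath (Q := Q) v w) where
  src_eq := by rw [finalPath, Path2.src_comp1, src_words]
  length_tgt := by
    rw [finalPath, Path2.tgt_comp1]
    rfl
  size_le := by
    have h₁ : (words (Q := Q) [v, w]).size (sig A Q).conCellsᶜ = 0 := words_generated _
    have h₂ : (eraser (A := A) (Q := Q)).1.size (sig A Q).conCellsᶜ = 1 :=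
      (Signature.size_eraseCell _).1
    have h₃ : (wire (A := A) (Q := Q)).1.size (sig A Q).conCellsᶜ = 0 := rfl
    rw [finalPath, Path2.size_comp1, Path2.size_comp0]
    omega
  size_eq := by
    have h₁ : (words (Q := Q) [v, w]).size (sig A Q).conCellsᶜ = 0 := words_generated _
    have h₂ : (eraser (A := A) (Q := Q)).1.size (sig A Q).conCellsᶜ = 1 :=
      (Signature.size_eraseCell _).1
    have h₃ : (wire (A := A) (Q := Q)).1.size (sig A Q).conCellsᶜ = 0 := rfl
    have h₄ := Path2.size_mono Signature.eraseCells_subset (words (Q := Q) [v, w])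
    have h₅ : (eraser (A := A) (Q := Q)).1.size (sig A Q).eraseCells = 1 :=
      (Signature.size_eraseCell _).2.2
    have h₆ : (wire (A := A) (Q := Q)).1.size (sig A Q).eraseCells = 0 := rfl
    rw [finalPath, Path2.size_comp1, Path2.size_comp0, Path2.size_comp1, Path2.size_comp0]
    omega
  eval_eq := by
    rw [finalPath, eval_comp1 _ _ _ _ (by rw [src_words]; rfl), eval_words]
    refine ((treeModel A Q).eval_comp0 eraser.1 wire.1 [wordTree v] [wordTree w] rfl rfl).trans ?_
    rw [eval_eraser, eval_wire]
    rfl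

/-- The sizes of the target of an erasing 3-cell. -/
theorem size_erase_target (φ : (sig A Q).Con) :
    (Signature.StructCell.erase φ).target.1.size (sig A Q).conCellsᶜ ≤ 1 ∧
    (Signature.StructCell.erase φ).target.1.size (sig A Q).eraseCells =
      (Signature.StructCell.erase φ).target.1.size (sig A Q).conCellsᶜ ∧
    (Signature.StructCell.erase φ).target.1.size Set.univ <
      (Signature.StructCell.erase φ).source.1.size Set.univ := by
  have e : (Signature.StructCell.erase φ).source.1.size Set.univ = 2 := by
    refine congrArg₂ (· + ·) (x' := 1) (y' := 1) (if_pos trivial) (if_pos trivial)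
  rcases φ with _ | a
  · have h : ∀ X, (Signature.StructCell.erase (S := sig A Q) Letter.nil).target.1.size X = 0 :=
      fun _ => rfl
    rw [e, h, h, h]
    omega
  · have h : ∀ X, (Signature.StructCell.erase (S := sig A Q) (Letter.letter a)).target.1.size X =
      (eraser (A := A) (Q := Q)).1.size X + 0 := fun _ => rfl
    have h₁ : (eraser (A := A) (Q := Q)).1.size (sig A Q).conCellsᶜ = 1 :=
      (Signature.size_eraseCell _).1
    have h₂ : (eraser (A := A) (Q := Q)).1.size (sig A Q).eraseCells = 1 :=
      (Signature.size_eraseCell _).2.2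
    have h₃ : (eraser (A := A) (Q := Q)).1.size Set.univ = 1 := if_pos trivial
    rw [e, h, h, h]
    omega

/-- A closed word always ends with a constructor, so an eraser placed under it forms the source of
an erasing 3-cell. -/
theorem exists_column_eq (w : List (Option A)) : ∃ (z : (sig A Q).poly2.Path2)
    (φ : (sig A Q).Con) (h : z.tgt = (Signature.conCell φ).1.src),
    words [w] = z.comp1 (Signature.conCell φ).1 h := by
  cases w with
  | nil =>
    refine ⟨.id [], Letter.nil, rfl, Path2.cls_injective ?_⟩
    rw [words_singleton]
    exact (Cls.one_c1 (nil (A := A) (Q := Q)).1.cls rfl).symm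
  | cons a w =>
    refine ⟨(wordPath w).1, Letter.letter a, (wordPath w).2.2, ?_⟩
    rw [words_singleton]
    rfl

/-- The tree of a word never has a `step` at its root. -/
theorem Erasing.ne_configPath {w : List (Option A)} {f : (sig A Q).poly2.Path2}
    (hf : Erasing w f) (x : M.Config) : f ≠ configPath x := by
  rintro rfl
  have := hf.eval_eq
  rw [eval_configPath] at this
  cases w <;> simp at this

/-! ### Executions -/

/-- Every configuration that is not final has a successor. -/
theorem exists_step (x : M.Config) (h : x.state ≠ M.qf) : ∃ y, M.Step x y := by
  obtain ⟨q, a, v, w⟩ := x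
  rcases e : M.δ (⟨q, h⟩, a) with ⟨q₂, c, _ | _⟩
  · cases v with
    | nil => exact ⟨_, _, .leftNil ⟨q, h⟩ a q₂ c e w⟩
    | cons b v => exact ⟨_, _, .leftCons ⟨q, h⟩ a q₂ c e b v w⟩
  · cases w with
    | nil => exact ⟨_, _, .rightNil ⟨q, h⟩ a q₂ c e v⟩
    | cons b w => exact ⟨_, _, .rightCons ⟨q, h⟩ a q₂ c e b v w⟩

theorem step_deterministic {x y z : M.Config} (hy : M.Step x y) (hz : M.Step x z) : y = z :=
  (stepBy_deterministic hy.choose_spec hz.choose_spec).2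

theorem not_step_of_final {x y : M.Config} (hx : x.state = M.qf) : ¬ M.Step x y :=
  fun h => stepBy_state_ne h.choose_spec hx

/-- The final configuration that is reached is unique. -/
theorem steps_final_unique {x y z : M.Config} (hy : M.Steps x y) (hz : M.Steps x z)
    (qy : y.state = M.qf) (qz : z.state = M.qf) : y = z := by
  unfold Steps at hy hz
  induction hy using Relation.ReflTransGen.head_induction_on with
  | refl =>
    obtain rfl | ⟨_, h, -⟩ := hz.cases_head
    · rfl
    · exact absurd h (not_step_of_final qy)
  | head r _ ih =>
    obtain rfl | ⟨_, h, hz'⟩ := hz.cases_head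
    · exact absurd r (not_step_of_final qz)
    · exact ih (step_deterministic h r ▸ hz')

/-! ### Termination and result of the erasing phase -/

section

variable [Finite A] [Finite Q]

/-- The only possible non-constructor is an eraser, so the 3-cell is an erasing one `φ ⋆₁ ε ⇛ ε_x`.
It replaces two 2-cells by at most one, and leaves at most one eraser. -/
theorem Erasing.reduces {w : List (Option A)} {f g : (sig A Q).poly2.Path2} (hf : Erasing w f)
    (h : Reduces (P := M.program.poly3) f g) :
    Erasing w g ∧ g.size Set.univ < f.size Set.univ := by
  obtain ⟨α, h⟩ := reduces_iff.mp h
  have hle := hf.size_le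
  have heq := hf.size_eq
  rcases α with α | c
  · obtain ⟨k, u, v, l, H, H'⟩ := reducesBy_inl_iff.mp h
    have h₁ := H.size_path (sig A Q).conCellsᶜ
    have h₂ := H.size_path (sig A Q).eraseCells
    have h₃ := Path2.size_mono Signature.eraseCells_subset k
    have h₄ := Path2.size_mono Signature.eraseCells_subset l
    obtain ⟨h₅, -, h₆ | ⟨φ, rfl⟩⟩ := Signature.StructCell.size_source (S := sig A Q) α
    · omega
    · obtain ⟨h₇, h₈, h₉⟩ := size_erase_target φ
      refine ⟨⟨?_, ?_, ?_, ?_, ?_⟩, ?_⟩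
      · rw [H'.src_path, ← H.src_path, hf.src_eq]
      · rw [H'.tgt_path, ← H.tgt_path, hf.length_tgt]
      · rw [H'.size_path]
        omega
      · rw [H'.size_path, H'.size_path]
        omega
      · rw [← hf.eval_eq]
        refine ((treeModel A Q).eval_eq_of_isPlug H H' ?_ ?_ [] ?_).symm
        · exact (Signature.StructCell.erase φ).source.2.1.trans
            (Signature.StructCell.erase φ).target.2.1.symm
        -- Both sides of the 3-cell have no output, so both evaluate to the empty list.
        · intro ys hys
          have e₁ : (Signature.StructCell.erase φ).source.1.tgt.length = 0 :=
            congrArg List.length (Signature.StructCell.erase φ).source.2.2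
          have e₂ : (Signature.StructCell.erase φ).target.1.tgt.length = 0 :=
            congrArg List.length (Signature.StructCell.erase φ).target.2.2
          rw [List.eq_nil_of_length_eq_zero (((treeModel A Q).length_eval _ ys hys).trans e₁),
            List.eq_nil_of_length_eq_zero (((treeModel A Q).length_eval _ ys (hys.trans (congrArg _
              ((Signature.StructCell.erase φ).source.2.1.trans
              (Signature.StructCell.erase φ).target.2.1.symm)))).trans e₂)]
        · rw [hf.src_eq]
          rfl
      · rw [H.size_path, H'.size_path]
        omega
  · obtain ⟨k, u, v, l, H, -⟩ := reducesBy_inr_iff.mp h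
    have h₁ := H.size_path (sig A Q).conCellsᶜ
    have h₂ := H.size_path (sig A Q).eraseCells
    have h₃ := Path2.size_mono Signature.eraseCells_subset k
    have h₄ := Path2.size_mono Signature.eraseCells_subset l
    have h₅ := size_compSource c
    have h₆ : (compSource c).1.size (sig A Q).eraseCells +
        (compSource c).1.size (sig A Q).funCells ≤ (compSource c).1.size (sig A Q).conCellsᶜ := by
      refine Path2.size_add_le ?_ Signature.eraseCells_subset Signature.funCells_subset _
      rintro _ ⟨ξ, rfl⟩ ⟨φ, h⟩
      cases h
    omega

/-- Without an eraser only constructors remain, and the tree determines the word. Otherwise the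
eraser has a word above it, whose last constructor it can absorb. -/
theorem Erasing.eq_or_reduces {w : List (Option A)} {f : (sig A Q).poly2.Path2}
    (hf : Erasing w f) :
    f = (wordPath w).1 ∨ ∃ g, Reduces (P := M.program.poly3) f g := by
  by_cases h : f.size (sig A Q).eraseCells = 0
  · left
    rw [← words_singleton]
    exact eq_words_of_eval f (hf.size_eq.symm.trans h) hf.src_eq _ hf.eval_eq
  · right
    obtain ⟨_, ⟨ξ, rfl⟩, k, u, v, l, H⟩ := f.exists_isPlug_cell _ h
    have h₁ := H.size_path (sig A Q).conCellsᶜ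
    have h₂ : (Path2.cell (P := (sig A Q).poly2) (Signature.Cell.erase ξ)).size
      (sig A Q).conCellsᶜ = 1 := (Signature.size_eraseCell ξ).1
    have h₃ := hf.size_le
    have hk : k.GeneratedBy (sig A Q).conCells := by
      unfold Path2.GeneratedBy
      omega
    obtain ⟨ws, rfl⟩ := exists_words k hk (by rw [← H.src_path, hf.src_eq])
    have hlen : ws.length = u.length + (1 + v.length) := by
      rw [← length_tgt_words (Q := Q), ← H.src_eq, List.length_append, List.length_append]
      rfl
    -- The eraser has `u.length` wires on its left, so `x`, at that index, is the word it erases.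
    obtain ⟨us, x, vs, rfl, hu, hv⟩ : ∃ us x vs, ws = us ++ ([x] ++ vs) ∧
        us.length = u.length ∧ vs.length = v.length := by
      refine ⟨ws.take u.length, ws[u.length]'(by omega), ws.drop (u.length + 1), ?_, ?_, ?_⟩
      · simp
      · simp
        omega
      · simp
        omega
    obtain ⟨z, φ, hz, hx⟩ := exists_column_eq (Q := Q) x
    have hu' : (words (Q := Q) us).tgt = u := onePath_ext ((length_tgt_words _).trans hu)
    have hv' : (words (Q := Q) vs).tgt = v := onePath_ext ((length_tgt_words _).trans hv)
    -- The last constructor of `x` slides down from the upper part of the context to the eraser,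
    -- completing a redex.
    have K : IsPlug ((words us).comp0 (z.comp0 (words vs))) u v l
        (Signature.StructCell.erase φ).source.1 f := by
      refine ⟨?_, H.tgt_eq, ?_⟩
      · rw [Path2.tgt_comp0, Path2.tgt_comp0, hu', hv', hz]
        rfl
      · rw [H.cls_eq, words_append, words_append, hx]
        have e : (Signature.StructCell.erase φ).source.1.cls =
          Cls.c1 (Signature.conCell φ).1.cls
            (Path2.cell (P := (sig A Q).poly2) (Signature.Cell.erase ξ)).cls := rfl
        rw [e]
        exact Cls.slide _ _ _ _ _ _ hu' hv' hz rfl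
    obtain ⟨g, K'⟩ := exists_isPlug _ u v l (Signature.StructCell.erase φ).target.1
      ((congrArg (fun x => u ++ (x ++ v)) ((Signature.StructCell.erase φ).target.2.1.trans
        (Signature.StructCell.erase φ).source.2.1.symm)).trans K.src_eq)
      ((congrArg (fun x => u ++ (x ++ v)) ((Signature.StructCell.erase φ).target.2.2.trans
        (Signature.StructCell.erase φ).source.2.2.symm)).trans K.tgt_eq)
    exact ⟨g, reduces_iff.mpr ⟨_, reducesBy_inl_iff.mpr ⟨_, _, _, _, K, K'⟩⟩⟩

/-- The source of every 3-cell contains a non-constructor, and a word contains none. -/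
theorem isNormal_wordPath (w : List (Option A)) :
    IsNormal (P := M.program.poly3) (wordPath w).1 := by
  intro g h
  obtain ⟨α, h⟩ := reduces_iff.mp h
  have h₀ : (wordPath (Q := Q) w).1.size (sig A Q).conCellsᶜ = 0 := wordPath_generated w
  rcases α with α | c
  · obtain ⟨k, u, v, l, H, -⟩ := reducesBy_inl_iff.mp h
    have h₁ := H.size_path (sig A Q).conCellsᶜ
    have h₂ := (Signature.StructCell.size_source (S := sig A Q) α).1
    omega
  · obtain ⟨k, u, v, l, H, -⟩ := reducesBy_inr_iff.mp h
    have h₁ := H.size_path (sig A Q).conCellsᶜ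
    have h₂ := (size_compSource c).1
    omega

variable (M) in
theorem Erasing.exists_path {w : List (Option A)} {f : (sig A Q).poly2.Path2}
    (hf : Erasing w f) :
    Relation.ReflTransGen (Reduces (P := M.program.poly3)) f (wordPath w).1 := by
  -- The number of all 2-cells is the termination measure.
  induction hn : f.size Set.univ using Nat.strong_induction_on generalizing f with
  | _ n ih =>
    obtain rfl | ⟨g, r⟩ := hf.eq_or_reduces (M := M)
    · exact .refl
    · obtain ⟨hg, hlt⟩ := hf.reduces r
      exact (ih _ (hn ▸ hlt) hg rfl).head r

theorem Erasing.eq_of_isNormal {w : List (Option A)} {f : (sig A Q).poly2.Path2}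
    (hf : Erasing w f) (h : IsNormal (P := M.program.poly3) f) : f = (wordPath w).1 := by
  obtain e | ⟨g, r⟩ := hf.eq_or_reduces (M := M)
  · exact e
  · exact absurd r (h g)

/-! ### Normal forms of complete executions -/

theorem reduces_of_step {x y : M.Config} (h : M.Step x y) :
    Reduces (P := M.program.poly3) (configPath x) (configPath y) :=
  reduces_iff.mpr ⟨_, reducesBy_of_stepBy h.choose_spec⟩

theorem reflTransGen_of_steps {x y : M.Config} (h : M.Steps x y) :
    Relation.ReflTransGen (Reduces (P := M.program.poly3)) (configPath x) (configPath y) := by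
  induction h with
  | refl => exact .refl
  | tail _ r ih => exact ih.tail (reduces_of_step r)

/-- A 2-path that is reached from a configuration either is a configuration that the machine
reaches, or comes after the end of the computation. -/
theorem steps_or_erasing {x : M.Config} {g : (sig A Q).poly2.Path2}
    (h : Relation.ReflTransGen (Reduces (P := M.program.poly3)) (configPath x) g) :
    ∃ y, M.Steps x y ∧ (g = configPath y ∨ y.state = M.qf ∧ Erasing y.right g) := by
  induction h with
  | refl => exact ⟨x, .refl, .inl rfl⟩
  | @tail f g _ r ih =>
    obtain ⟨y, hy, rfl | ⟨hq, he⟩⟩ := ih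
    · obtain ⟨α, r⟩ := reduces_iff.mp r
      obtain ⟨r', z, -, rfl, hz⟩ | ⟨hq, -, rfl⟩ := stepBy_of_reducesBy r
      · exact ⟨z, hy.tail ⟨r', hz⟩, .inl rfl⟩
      · exact ⟨y, hy, .inr ⟨hq, erasing_finalPath _ _⟩⟩
    · exact ⟨y, hy, .inr ⟨hq, (he.reduces r).1⟩⟩

/-- No configuration is normal: the final 3-cell applies in state `qf`, and a transition in any
other state. A normal form therefore lies in the erasing phase, where only the word is normal. -/
theorem exists_final_of_isNormal {x : M.Config} {g : (sig A Q).poly2.Path2}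
    (h : Relation.ReflTransGen (Reduces (P := M.program.poly3)) (configPath x) g)
    (hg : IsNormal (P := M.program.poly3) g) :
    ∃ y, M.Steps x y ∧ y.state = M.qf ∧ g = (wordPath y.right).1 := by
  obtain ⟨y, hy, rfl | ⟨hq, he⟩⟩ := steps_or_erasing h
  · by_cases hq : y.state = M.qf
    · obtain ⟨q, a, v, w⟩ := y
      obtain rfl : q = M.qf := hq
      exact absurd (reduces_iff.mpr ⟨_, reducesBy_finish a v w⟩) (hg _)
    · obtain ⟨z, hz⟩ := exists_step y hq
      exact absurd (reduces_of_step hz) (hg _)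
  · exact ⟨y, hy, hq, he.eq_of_isNormal hg⟩

/-- `main` applied to a word has the initial configuration as its only reduct, which reduces the
question to executions of the machine. -/
theorem isNormalFormOf_mainPath_iff (w : List (Option A)) (g : (sig A Q).poly2.Path2) :
    IsNormalFormOf (P := M.program.poly3) g (mainPath w) ↔
      ∃ y, M.Steps (M.start w) y ∧ y.state = M.qf ∧ g = (wordPath y.right).1 := by
  have r : Reduces (P := M.program.poly3) (mainPath w) (configPath (M.start w)) :=
    reduces_iff.mpr ⟨_, reducesBy_init w⟩
  constructor
  · rintro ⟨h, hg⟩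
    obtain rfl | ⟨f, h₁, h₂⟩ := h.cases_head
    · exact absurd r (hg _)
    · obtain ⟨α, h₁⟩ := reduces_iff.mp h₁
      obtain rfl := eq_of_reducesBy_mainPath h₁
      exact exists_final_of_isNormal h₂ hg
  · rintro ⟨⟨q, a, u, v⟩, hs, rfl, rfl⟩
    refine ⟨.head r ((reflTransGen_of_steps hs).trans (.head (b := finalPath u v) ?_ ?_)),
      isNormal_wordPath _⟩
    · exact reduces_iff.mpr ⟨_, reducesBy_finish a u v⟩
    · exact (erasing_finalPath u v).exists_path M

/-! ### Values and the semantics of the main function -/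

theorem word_injective : Function.Injective M.word := by
  intro v w h
  have e : (wordPath (Q := Q) v).1 = (wordPath w).1 := congrArg (fun t => t.1.1) h
  have e' := congrArg (fun f => (treeModel A Q).eval f []) e
  simp only [← words_singleton, eval_words, List.map_cons, List.map_nil, List.cons.injEq,
    and_true] at e'
  exact wordTree_injective e'

theorem word_surjective : Function.Surjective M.word := by
  rintro ⟨⟨f, hs, ht⟩, hf⟩
  obtain ⟨ws, rfl⟩ := exists_words f hf hs
  obtain ⟨w, rfl⟩ : ∃ w, ws = [w] := by
    apply List.length_eq_one_iff.mp
    rw [← length_tgt_words (Q := Q) ws]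
    exact congrArg List.length ht
  exact ⟨w, Subtype.ext (Subtype.ext (words_singleton w).symm)⟩

/-- Determinism makes the final configuration unique, so existence of a normal form already gives
the uniqueness that the semantics demands. -/
theorem word_mem_mainSem_iff (w v : List (Option A)) : M.word v ∈ M.mainSem (M.word w) ↔
    ∃ (a : Option A) (u : List (Option A)), M.Steps (M.start w) ⟨M.qf, a, u, v⟩ := by
  refine (PolygraphicProgram.mem_sem_iff (P := M.program) _ _ _).trans ?_
  constructor
  · intro h
    obtain ⟨⟨q, a, u, v'⟩, hs, rfl, e⟩ :=
      (isNormalFormOf_mainPath_iff w (wordPath v).1).mp ((h _).mpr rfl)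
    obtain rfl : v = v' := word_injective (M := M) (Subtype.ext (Subtype.ext e))
    exact ⟨a, u, hs⟩
  · rintro ⟨a, u, hs⟩ g
    refine (isNormalFormOf_mainPath_iff w g).trans ⟨?_, ?_⟩
    · rintro ⟨y, hy, hq, rfl⟩
      rw [steps_final_unique hy hs hq rfl]
      rfl
    · rintro rfl
      exact ⟨_, hs, rfl, rfl⟩

end

end TuringMachine

/-! ### The theorem -/

theorem theorem1p12 {A Q : Type u} [Finite A] [Finite Q] (M : TuringMachine A Q) :
    -- values of type `w` are the words over the extended alphabet
    Function.Bijective M.word ∧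
    -- configurations are faithfully encoded as 2-paths
    Function.Injective M.encode ∧
    -- the cases of the transition relation correspond to the transition 3-cells
    (∀ (r : M.Rule) (x y : M.Config),
      M.StepBy r x y ↔ Polygraph3.ReducesBy (M.ruleCell r) (M.encode x) (M.encode y)) ∧
    -- each transition is simulated by exactly one 3-cell of the program
    (∀ x y : M.Config, M.Step x y →
      ∃! α, Polygraph3.ReducesBy α (M.encode x) (M.encode y)) ∧
    -- a configuration that is not final has no other reduction than its transitions
    (∀ (x : M.Config) (α : M.program.poly3.ThreeCell) (g : M.program.poly3.Path2),
      Polygraph3.ReducesBy α (M.encode x) g →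
        (∃ (r : M.Rule) (y : M.Config), α = M.ruleCell r ∧ g = M.encode y ∧ M.StepBy r x y) ∨
        (x.state = M.qf ∧ α = M.finishCell x.read)) ∧
    -- sequences of transitions correspond to 3-paths
    (∀ x y : M.Config, M.Steps x y ↔ Polygraph3.HasPath (M.encode x) (M.encode y)) ∧
    -- the main function 2-cell computes exactly what the machine computes, on all words
    (∀ w v : List (Option A), M.word v ∈ M.mainSem (M.word w) ↔
      ∃ (a : Option A) (u : List (Option A)), M.Steps (M.start w) ⟨M.qf, a, u, v⟩) ∧
    -- in particular, on words without blanks it is the map computed by the machine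
    (∀ f : List A → List A, M.Computes f → ∀ w : List A,
      M.mainSem (M.word (w.map some)) = Part.some (M.word ((f w).map some))) := by
  refine ⟨⟨TuringMachine.word_injective, TuringMachine.word_surjective⟩,
    TuringMachine.configPath_injective, fun r x y => ⟨TuringMachine.reducesBy_of_stepBy, ?_⟩,
    ?_, ?_, fun x y => ?_, TuringMachine.word_mem_mainSem_iff, ?_⟩
  · intro h
    obtain ⟨r', y', hr, hy, hs⟩ | ⟨-, hr, -⟩ := TuringMachine.stepBy_of_reducesBy h
    · obtain rfl := TuringMachine.configPath_injective hy
      cases hr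
      exact hs
    · cases hr
  · rintro x y ⟨r, hr⟩
    refine ⟨_, TuringMachine.reducesBy_of_stepBy hr, fun α h => ?_⟩
    -- A competing 3-cell comes from a rule applicable to `x`, unique by determinism; the final
    -- 3-cell would need the state `qf`, from which no transition starts.
    obtain ⟨r', y', rfl, hy, hs⟩ | ⟨hq, -, -⟩ := TuringMachine.stepBy_of_reducesBy h
    · rw [(TuringMachine.stepBy_deterministic hr hs).1]
    · exact absurd hq (TuringMachine.stepBy_state_ne hr)
  · intro x α g h
    obtain H | ⟨hq, hα, -⟩ := TuringMachine.stepBy_of_reducesBy h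
    · exact .inl H
    · exact .inr ⟨hq, hα⟩
  · refine Iff.trans ⟨TuringMachine.reflTransGen_of_steps, fun h => ?_⟩
      Polygraph3.hasPath_iff.symm
    -- A 3-path that ends at a configuration has not entered the erasing phase, which is never left
    -- and contains no configuration.
    obtain ⟨z, hz, e | ⟨-, he⟩⟩ := TuringMachine.steps_or_erasing h
    · rwa [TuringMachine.configPath_injective e]
    · exact absurd rfl (he.ne_configPath y)
  · intro f hf w
    obtain ⟨a, v, h⟩ := hf w
    exact Part.eq_some_iff.mpr ((TuringMachine.word_mem_mainSem_iff _ _).mpr ⟨a, v, h⟩)
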